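/- **Setting.** Let $d\in\{2,3\}$, $k\ge 1$, and let $\Omega\subset\mathbb R^d$ be a polygonal/polyhedral domain (the interior of a finite union of simplices). Write $\|\cdot\|$ and $(\cdot,\cdot)$ for the norm and scalar product of $L^2(\Omega)$, and $|v|_{H^m(\Omega)}=\|D^m v\|$. Let $V,W$ be subspaces of $H^1(\Omega)$ and $a:V\times W\to\mathbb R$ a bilinear form. For $f,g\in L^2(\Omega)$ consider the forward and the adjoint problem $$u\in V:\ a(u,w)=(f,w)\ \ \forall w\in W,\qquad\qquad z\in W:\ a(v,z)=(g,v)\ \ \forall v\in V .$$ Let $\mathcal T_h$ be a conforming triangulation of $\Omega$ into closed simplices with mesh size $h=\max_K h_K$, $h_K=\operatorname{diam}K$. It is shape regular and quasi-uniform with constants $\sigma,\tau$: each $K$ contains a ball of radius $r$ with $h_K\le\sigma r$, and $h\le\tau h_K$. Let $\|\cdot\|_h$ denote the elementwise $L^2$-norm. Let $V_h,W_h$ be subspaces of $X_h^k=\{v\in H^1(\Omega): v|_K\in\mathbb P_k(K)\ \forall K\in\mathcal T_h\}$ and put $$S_V=(V\cap H^2(\Omega))+V_h,\qquad S_W=(W\cap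 H^2(\Omega))+W_h .$$ Let $a_h:S_V\times S_W\to\mathbb R$ be bilinear. Let $s_p$ on $S_V$ and $s_a$ on $S_W$ be symmetric positive semidefinite bilinear forms, with $|v|_{S_p}=s_p(v,v)^{1/2}$ and $|w|_{S_a}=s_a(w,w)^{1/2}$. Let $\|\cdot\|_+$ and $\|\cdot\|_{\mathcal L}$ be seminorms on $S_V$, and $\|\cdot\|_*$ a seminorm on $S_W$. Let $\pi_V:V\to V_h$ and $\pi_W:W\to W_h$ be maps and $\epsilon(h)\ge0$ a real number. **Assumptions**, with positive constants $c_{a,\Omega},c_{a,\gamma},c_a,c_i$: 1. *(Well-posedness and smoothing.)* For all $f,g\in L^2(\Omega)$ the forward and the adjoint problem have exactly one solution $u$, respectively $z$. These lie in $H^2(\Omega)$, with $|u|_{H^2(\Omega)}\le c_{a,\Omega}\|f\|$ and $|z|_{H^2(\Omega)}\le c_{a,\Omega}\|g\|$. 2. *(Consistency.)* For all $f,g\in L^2(\Omega)$: if $u$ solves the forward problem with data $f$, then $a_h(u,\varphi)=(f,\varphi)$ for all $\varphi\in S_W$. If $z$ solves the adjoint problem with data $g$, then $a_h(\phi,z)=(\phi,g)$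 for all $\phi\in S_V$. 3. *(Interpolation.)* For $j=1$ and $j=k$, $$\|v-\pi v\|+h\|\nabla(v-\pi v)\|+h^2\|D^2(v-\pi v)\|_h\le c_i h^{j+1}|v|_{H^{j+1}(\Omega)}$$ for $\pi=\pi_V$, $v\in V\cap H^{j+1}(\Omega)$, and for $\pi=\pi_W$, $v\in W\cap H^{j+1}(\Omega)$. 4. *(Continuity.)* For all $v\in V\cap H^2(\Omega)$, $y\in W\cap H^2(\Omega)$, $v_h\in V_h$, $x_h\in W_h$, $$a_h(v-\pi_Vv,x_h)\le\|v-\pi_Vv\|_+\,(c_a|x_h|_{S_a}+\epsilon(h)\|x_h\|),$$ $$a_h(v-v_h,y-\pi_Wy)\le\|y-\pi_Wy\|_*\,(c_a\|v-\pi_Vv\|_{\mathcal L}+c_a|v_h-\pi_Vv|_{S_p}+\epsilon(h)\|v-v_h\|).$$ 5. *(Approximation.)* For $j=1$ and $j=k$, $$\|v-\pi_Vv\|_{\mathcal L}+\|v-\pi_Vv\|_++|v-\pi_Vv|_{S_p}\le c_{a,\gamma}h^j|v|_{H^{j+1}(\Omega)}\quad\forall v\in V\cap H^{j+1}(\Omega),$$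 $$\|w-\pi_Ww\|_*+|w-\pi_Ww|_{S_a}\le c_{a,\gamma}h^j|w|_{H^{j+1}(\Omega)}\quad\forall w\in W\cap H^{j+1}(\Omega),$$ and $|\pi_Ww|_{S_a}\le c_{a,\gamma}h|w|_{H^2(\Omega)}$ for all $w\in W\cap H^2(\Omega)$, and $|\pi_Vv|_{S_p}\le c_{a,\gamma}h|v|_{H^2(\Omega)}$ for all $v\in V\cap H^2(\Omega)$. **Theorem.** There are a constant $c_0>0$ depending only on $d,k,c_{a,\Omega},c_{a,\gamma}$ and a constant $C>0$ depending only on these and on $c_a,c_i,\sigma,\tau$ (in particular not on $h$), such that the following holds whenever the assumptions above are satisfied and $$c_0\,h\,\epsilon(h)\le\tfrac16 .$$ Let $f\in L^2(\Omega)$ and let $u\in V$ be the solution of the forward problem. Then there is exactly one pair $(u_h,z_h)\in V_h\times W_h$ with $$a_h(u_h,w_h)+s_a(z_h,w_h)=(f,w_h)\quad\forall w_h\in W_h,$$ $$a_h(v_h,z_h)-s_p(u_h,v_h)=-s_p(u,v_h)\quad\forall v_h\in V_h .$$ If $u\in H^{k+1}(\Omega)$, it satisfies $$\|u-u_h\|+h\|\nabla(u-u_h)\|+\|z_h\|\le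 C\,h^{k+1}|u|_{H^{k+1}(\Omega)},$$ and in any case $$\|u-u_h\|+h\|\nabla(u-u_h)\|+\|z_h\|\le C\,h^2\|f\|.$$ -/

import Mathlib

open MeasureTheory Geometry
open scoped ContDiff

noncomputable section

/-! ## Sobolev spaces through weak derivatives -/

/-- Euclidean space of dimension `d`. -/
abbrev E (d : ℕ) : Type := EuclideanSpace ℝ (Fin d)

/-- The (classical) partial derivative `∂_{i 0} ⋯ ∂_{i (m-1)} φ` of order `m`. -/
def partialDeriv {d m : ℕ} (i : Fin m → Fin d) (φ : E d → ℝ) (x : E d) : ℝ :=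
  iteratedFDeriv ℝ m φ x fun j => EuclideanSpace.single (i j) (1 : ℝ)

/-- Test functions: smooth with compact support in `U`. -/
structure IsTest {d : ℕ} (U : Set (E d)) (φ : E d → ℝ) : Prop where
  smooth : ContDiff ℝ ∞ φ
  compact : HasCompactSupport φ
  support : tsupport φ ⊆ U

/-- `g` is a square integrable weak derivative `∂_{i 0} ⋯ ∂_{i (m-1)} v` on `U`. -/
def HasWeakDeriv {d m : ℕ} (U : Set (E d)) (i : Fin m → Fin d) (v g : E d → ℝ) : Prop :=
  MemLp g 2 (volume.restrict U) ∧
    ∀ φ : E d → ℝ, IsTest U φ →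
      ∫ x in U, v x * partialDeriv i φ x = (-1) ^ m * ∫ x in U, g x * φ x

open Classical in
/-- The weak derivative (unique up to null sets of the open set `U`, when it exists). -/
def weakDeriv {d m : ℕ} (U : Set (E d)) (i : Fin m → Fin d) (v : E d → ℝ) : E d → ℝ :=
  if h : ∃ g, HasWeakDeriv U i v g then h.choose else 0

/-- The seminorm `|v|_{H^m(U)} = ‖D^m v‖_{L²(U)}`, with the Frobenius norm of the tensor `D^m v`;
for `m = 1` this is `‖∇ v‖`. -/
def hSeminorm {d : ℕ} (U : Set (E d)) (m : ℕ) (v : E d → ℝ) : ℝ :=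
  Real.sqrt (∑ i : Fin m → Fin d, ∫ x in U, (weakDeriv U i v x) ^ 2)

/-- `L²(Ω)`, with its norm `‖·‖` and scalar product. -/
abbrev L2 {d : ℕ} (Ω : Set (E d)) : Type := Lp ℝ 2 (volume.restrict Ω)

lemma partialDeriv_memLp {d m : ℕ} (U : Set (E d)) (i : Fin m → Fin d) {φ : E d → ℝ}
    (h : IsTest U φ) : MemLp (partialDeriv i φ) 2 (volume.restrict U) := by
  have hc : Continuous (partialDeriv i φ) := by
    have h1 : Continuous (iteratedFDeriv ℝ m φ) :=
      h.smooth.continuous_iteratedFDeriv (by exact_mod_cast le_top)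
    have h2 : Continuous fun L : (E d) [×m]→L[ℝ] ℝ =>
        L fun j => EuclideanSpace.single (i j) (1 : ℝ) :=
      (ContinuousMultilinearMap.apply ℝ (fun _ : Fin m => E d) ℝ
        fun j => EuclideanSpace.single (i j) (1 : ℝ)).continuous
    exact h2.comp h1
  have hs : HasCompactSupport (partialDeriv i φ) := by
    have h1 : HasCompactSupport (iteratedFDeriv ℝ m φ) := h.compact.iteratedFDeriv m
    exact h1.comp_left
      (g := fun L : (E d) [×m]→L[ℝ] ℝ => L fun j => EuclideanSpace.single (i j) (1 : ℝ)) (by simp)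
  exact (hc.memLp_of_hasCompactSupport hs).restrict U

lemma test_memLp {d : ℕ} (U : Set (E d)) {φ : E d → ℝ} (h : IsTest U φ) :
    MemLp φ 2 (volume.restrict U) :=
  (h.smooth.continuous.memLp_of_hasCompactSupport h.compact).restrict U

lemma HasWeakDeriv.add {d m : ℕ} {U : Set (E d)} {i : Fin m → Fin d} {v w g k : E d → ℝ}
    (hv : MemLp v 2 (volume.restrict U)) (hw : MemLp w 2 (volume.restrict U))
    (hg : HasWeakDeriv U i v g) (hk : HasWeakDeriv U i w k) :
    HasWeakDeriv U i (v + w) (g + k) := by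
  refine ⟨hg.1.add hk.1, fun φ hφ => ?_⟩
  have a1 := hv.integrable_mul (partialDeriv_memLp U i hφ)
  have a2 := hw.integrable_mul (partialDeriv_memLp U i hφ)
  have a3 := hg.1.integrable_mul (test_memLp U hφ)
  have a4 := hk.1.integrable_mul (test_memLp U hφ)
  have e1 : ∫ x in U, (v + w) x * partialDeriv i φ x =
      (∫ x in U, v x * partialDeriv i φ x) + ∫ x in U, w x * partialDeriv i φ x := by
    refine Eq.trans ?_ (integral_add a1 a2)
    simp only [Pi.add_apply, Pi.mul_apply, add_mul]
  have e2 : ∫ x in U, (g + k) x * φ x = (∫ x in U, g x * φ x) + ∫ x in U, k x * φ x := by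
    refine Eq.trans ?_ (integral_add a3 a4)
    simp only [Pi.add_apply, Pi.mul_apply, add_mul]
  rw [e1, e2, hg.2 φ hφ, hk.2 φ hφ, mul_add]

lemma HasWeakDeriv.smul {d m : ℕ} {U : Set (E d)} {i : Fin m → Fin d} {v g : E d → ℝ} (c : ℝ)
    (hg : HasWeakDeriv U i v g) : HasWeakDeriv U i (c • v) (c • g) := by
  refine ⟨hg.1.const_smul c, fun φ hφ => ?_⟩
  simp only [Pi.smul_apply, smul_eq_mul, mul_assoc, integral_const_mul, hg.2 φ hφ]
  ring

lemma HasWeakDeriv.congr {d m : ℕ} {U : Set (E d)} {i : Fin m → Fin d} {v w g : E d → ℝ}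
    (h : v =ᵐ[volume.restrict U] w) (hg : HasWeakDeriv U i v g) : HasWeakDeriv U i w g := by
  refine ⟨hg.1, fun φ hφ => ?_⟩
  rw [← hg.2 φ hφ]
  exact integral_congr_ae (h.symm.mono fun x hx => by simp only [hx])

/-- The Sobolev space `H^m(Ω)`: all weak derivatives of order at most `m` exist and are square
integrable. -/
def H {d : ℕ} (Ω : Set (E d)) (m : ℕ) : Submodule ℝ (L2 Ω) where
  carrier := {v | ∀ n ≤ m, ∀ i : Fin n → Fin d, ∃ g, HasWeakDeriv Ω i v g}
  add_mem' := by
    intro v w hv hw n hn i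
    obtain ⟨g, hg⟩ := hv n hn i
    obtain ⟨k, hk⟩ := hw n hn i
    exact ⟨g + k, (hg.add (Lp.memLp v) (Lp.memLp w) hk).congr (Lp.coeFn_add v w).symm⟩
  zero_mem' := by
    intro n _ i
    refine ⟨0, HasWeakDeriv.congr (Lp.coeFn_zero ℝ 2 _).symm ⟨MemLp.zero, fun φ _ => by simp⟩⟩
  smul_mem' := by
    intro c v hv n hn i
    obtain ⟨g, hg⟩ := hv n hn i
    exact ⟨c • g, (hg.smul c).congr (Lp.coeFn_smul c v).symm⟩

/-! ## Triangulations and finite element spaces -/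

/-- The elements of a simplicial complex, given by their vertices: its simplices of full
dimension. The element itself is the closed simplex `convexHull ℝ K`. -/
def elements {d : ℕ} (T : SimplicialComplex ℝ (E d)) : Set (Finset (E d)) :=
  {K | K ∈ T.faces ∧ K.card = d + 1}

/-- `T` is a (finite, conforming) triangulation of the polygonal/polyhedral set `Ω`. -/
structure IsTriangulation {d : ℕ} (Ω : Set (E d)) (T : SimplicialComplex ℝ (E d)) : Prop where
  finite : T.faces.Finite
  /-- every simplex is a face of an element -/
  pure : ∀ s ∈ T.faces, ∃ K ∈ elements T, s ⊆ K
  /-- the elements fill the polyhedral domain `Ω` -/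
  covers : interior (⋃ K ∈ elements T, convexHull ℝ (K : Set (E d))) = Ω

/-- The diameter `h_K` of an element. -/
def elementDiam {d : ℕ} (K : Finset (E d)) : ℝ := Metric.diam (convexHull ℝ (K : Set (E d)))

/-- The mesh size `h = max_K h_K`. -/
def meshSize {d : ℕ} (T : SimplicialComplex ℝ (E d)) : ℝ := sSup (elementDiam '' elements T)

/-- Shape regularity: each element contains a ball of radius comparable to its diameter. -/
def ShapeRegular {d : ℕ} (T : SimplicialComplex ℝ (E d)) (σ : ℝ) : Prop :=
  ∀ K ∈ elements T, ∃ (x : E d) (r : ℝ),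
    Metric.closedBall x r ⊆ convexHull ℝ (K : Set (E d)) ∧ elementDiam K ≤ σ * r

/-- Quasi-uniformity: all elements have a diameter comparable to the mesh size. -/
def QuasiUniform {d : ℕ} (T : SimplicialComplex ℝ (E d)) (τ : ℝ) : Prop :=
  ∀ K ∈ elements T, meshSize T ≤ τ * elementDiam K

/-- `v` coincides on the element `K` with a polynomial of degree at most `k`. -/
def IsPolyOn {d : ℕ} (k : ℕ) (K : Finset (E d)) (v : E d → ℝ) : Prop :=
  ∃ p : MvPolynomial (Fin d) ℝ, p.totalDegree ≤ k ∧
    v =ᵐ[volume.restrict (interior (convexHull ℝ (K : Set (E d))))]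
      fun x => MvPolynomial.eval (fun i => x i) p

/-- The elementwise (broken) seminorm `‖D^m v‖_h`. -/
def brokenSeminorm {d : ℕ} (T : SimplicialComplex ℝ (E d)) (m : ℕ) (v : E d → ℝ) : ℝ :=
  Real.sqrt (∑ᶠ K ∈ elements T, hSeminorm (interior (convexHull ℝ (K : Set (E d)))) m v ^ 2)

/-- `X_h^k` as a set of functions: `v ∈ H¹(Ω)` with `v|_K ∈ ℙ_k(K)` for all elements `K`. -/
def IsFEFunction {d : ℕ} {Ω : Set (E d)} (T : SimplicialComplex ℝ (E d)) (k : ℕ) (v : L2 Ω) :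
    Prop :=
  v ∈ H Ω 1 ∧ ∀ K ∈ elements T, IsPolyOn k K v

/-! ## The continuous problem -/

/-- The data of the weak formulation: subspaces `V, W` of `H¹(Ω)` and a bilinear form on
`V × W`. -/
structure Problem {d : ℕ} (Ω : Set (E d)) where
  V : Submodule ℝ (L2 Ω)
  W : Submodule ℝ (L2 Ω)
  V_le : V ≤ H Ω 1
  W_le : W ≤ H Ω 1
  a : V →ₗ[ℝ] W →ₗ[ℝ] ℝ

namespace Problem

variable {d : ℕ} {Ω : Set (E d)} (P : Problem Ω)

/-- `u ∈ V` solves the forward problem `a(u, w) = (f, w)` for all `w ∈ W`. -/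
def IsForwardSol (f : L2 Ω) (u : P.V) : Prop :=
  ∀ w : P.W, P.a u w = inner ℝ f (w : L2 Ω)

/-- `z ∈ W` solves the adjoint problem `a(v, z) = (g, v)` for all `v ∈ V`. -/
def IsAdjointSol (g : L2 Ω) (z : P.W) : Prop :=
  ∀ v : P.V, P.a v z = inner ℝ g (v : L2 Ω)

/-- Both problems have exactly one solution for all square integrable data. -/
structure WellPosed : Prop where
  forward : ∀ f : L2 Ω, ∃! u : P.V, P.IsForwardSol f u
  adjoint : ∀ g : L2 Ω, ∃! z : P.W, P.IsAdjointSol g z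

/-- The smoothing property with constant `c`: solutions are in `H²(Ω)`, with seminorm bounded
by `c` times the norm of the data. -/
structure Smoothing (c : ℝ) : Prop where
  forward : ∀ (f : L2 Ω) (u : P.V), P.IsForwardSol f u →
    (u : L2 Ω) ∈ H Ω 2 ∧ hSeminorm Ω 2 (u : L2 Ω) ≤ c * ‖f‖
  adjoint : ∀ (g : L2 Ω) (z : P.W), P.IsAdjointSol g z →
    (z : L2 Ω) ∈ H Ω 2 ∧ hSeminorm Ω 2 (z : L2 Ω) ≤ c * ‖g‖

end Problem

/-! ## The discretisation -/

/-- The data of the stabilised method on one mesh: discrete spaces `V_h, W_h ⊆ X_h^k`, the discrete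
bilinear form `a_h`, the symmetric positive semidefinite stabilisations `s_p`, `s_a`, interpolation
operators `π_V`, `π_W`, and the seminorms `‖·‖_+`, `‖·‖_ℒ`, `‖·‖_*`. The forms and seminorms are
defined for sums of `H²` functions of `V` (resp. `W`) and of discrete functions. -/
structure Discretisation {d : ℕ} {Ω : Set (E d)} (P : Problem Ω) (T : SimplicialComplex ℝ (E d))
    (k : ℕ) where
  Vh : Submodule ℝ (L2 Ω)
  Wh : Submodule ℝ (L2 Ω)
  Vh_fe : ∀ v ∈ Vh, IsFEFunction T k v
  Wh_fe : ∀ w ∈ Wh, IsFEFunction T k w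
  ah : ↥((P.V ⊓ H Ω 2) ⊔ Vh) →ₗ[ℝ] ↥((P.W ⊓ H Ω 2) ⊔ Wh) →ₗ[ℝ] ℝ
  sp : ↥((P.V ⊓ H Ω 2) ⊔ Vh) →ₗ[ℝ] ↥((P.V ⊓ H Ω 2) ⊔ Vh) →ₗ[ℝ] ℝ
  sa : ↥((P.W ⊓ H Ω 2) ⊔ Wh) →ₗ[ℝ] ↥((P.W ⊓ H Ω 2) ⊔ Wh) →ₗ[ℝ] ℝ
  sp_symm : ∀ v w, sp v w = sp w v
  sa_symm : ∀ v w, sa v w = sa w v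
  sp_nonneg : ∀ v, 0 ≤ sp v v
  sa_nonneg : ∀ v, 0 ≤ sa v v
  piV : P.V → Vh
  piW : P.W → Wh
  normPlus : Seminorm ℝ ↥((P.V ⊓ H Ω 2) ⊔ Vh)
  normL : Seminorm ℝ ↥((P.V ⊓ H Ω 2) ⊔ Vh)
  normStar : Seminorm ℝ ↥((P.W ⊓ H Ω 2) ⊔ Wh)

namespace Discretisation

variable {d k : ℕ} {Ω : Set (E d)} {P : Problem Ω} {T : SimplicialComplex ℝ (E d)}
  (D : Discretisation P T k)

/-- The space `(V ∩ H²(Ω)) + V_h`. -/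
abbrev SV : Submodule ℝ (L2 Ω) := (P.V ⊓ H Ω 2) ⊔ D.Vh

/-- The space `(W ∩ H²(Ω)) + W_h`. -/
abbrev SW : Submodule ℝ (L2 Ω) := (P.W ⊓ H Ω 2) ⊔ D.Wh

/-- Inclusion of `V ∩ H²(Ω)`. -/
def incV (v : P.V) (hv : (v : L2 Ω) ∈ H Ω 2) : D.SV :=
  ⟨v, Submodule.mem_sup_left ⟨v.2, hv⟩⟩

/-- Inclusion of `W ∩ H²(Ω)`. -/
def incW (w : P.W) (hw : (w : L2 Ω) ∈ H Ω 2) : D.SW :=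
  ⟨w, Submodule.mem_sup_left ⟨w.2, hw⟩⟩

/-- Inclusion of `V_h`. -/
def discV (v : D.Vh) : D.SV := ⟨v, Submodule.mem_sup_right v.2⟩

/-- Inclusion of `W_h`. -/
def discW (w : D.Wh) : D.SW := ⟨w, Submodule.mem_sup_right w.2⟩

/-- The stabilisation seminorm `|v|_{S_p} = s_p(v, v)^{1/2}`. -/
def seminormP (v : D.SV) : ℝ := Real.sqrt (D.sp v v)

/-- The stabilisation seminorm `|w|_{S_a} = s_a(w, w)^{1/2}`. -/
def seminormA (w : D.SW) : ℝ := Real.sqrt (D.sa w w)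

/-- Strong consistency of `a_h` with the forward and the adjoint problem
(for solutions `u`, `z` one has `ℒ u = f`, `ℒ* z = g`). -/
structure Consistent : Prop where
  forward : ∀ (f : L2 Ω) (u : P.V) (hu : (u : L2 Ω) ∈ H Ω 2), P.IsForwardSol f u →
    ∀ φ : D.SW, D.ah (D.incV u hu) φ = inner ℝ f (φ : L2 Ω)
  adjoint : ∀ (g : L2 Ω) (z : P.W) (hz : (z : L2 Ω) ∈ H Ω 2), P.IsAdjointSol g z →
    ∀ φ : D.SV, D.ah φ (D.incW z hz) = inner ℝ (φ : L2 Ω) g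

/-- The interpolation estimate
`‖v - πv‖ + h ‖∇(v - πv)‖ + h² ‖D²(v - πv)‖_h ≤ c h^{j+1} |v|_{H^{j+1}(Ω)}`
for `π = π_V, π_W` and the orders `j = 1` and `j = k`. -/
structure Interpolation (c : ℝ) : Prop where
  piV : ∀ j, j = 1 ∨ j = k → ∀ v : P.V, (v : L2 Ω) ∈ H Ω (j + 1) →
    ‖(v : L2 Ω) - D.piV v‖
      + meshSize T * hSeminorm Ω 1 ((v : L2 Ω) - D.piV v : L2 Ω)
      + meshSize T ^ 2 * brokenSeminorm T 2 ((v : L2 Ω) - D.piV v : L2 Ω)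
      ≤ c * meshSize T ^ (j + 1) * hSeminorm Ω (j + 1) (v : L2 Ω)
  piW : ∀ j, j = 1 ∨ j = k → ∀ w : P.W, (w : L2 Ω) ∈ H Ω (j + 1) →
    ‖(w : L2 Ω) - D.piW w‖
      + meshSize T * hSeminorm Ω 1 ((w : L2 Ω) - D.piW w : L2 Ω)
      + meshSize T ^ 2 * brokenSeminorm T 2 ((w : L2 Ω) - D.piW w : L2 Ω)
      ≤ c * meshSize T ^ (j + 1) * hSeminorm Ω (j + 1) (w : L2 Ω)

/-- The continuity relations of `a_h`, with constants `c` and `ε = ε(h)`. -/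
structure Continuity (c ε : ℝ) : Prop where
  cont1 : ∀ (v : P.V) (hv : (v : L2 Ω) ∈ H Ω 2) (x : D.Wh),
    D.ah (D.incV v hv - D.discV (D.piV v)) (D.discW x)
      ≤ D.normPlus (D.incV v hv - D.discV (D.piV v))
        * (c * D.seminormA (D.discW x) + ε * ‖(x : L2 Ω)‖)
  cont2 : ∀ (v : P.V) (hv : (v : L2 Ω) ∈ H Ω 2) (y : P.W) (hy : (y : L2 Ω) ∈ H Ω 2) (vh : D.Vh),
    D.ah (D.incV v hv - D.discV vh) (D.incW y hy - D.discW (D.piW y))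
      ≤ D.normStar (D.incW y hy - D.discW (D.piW y))
        * (c * D.normL (D.incV v hv - D.discV (D.piV v))
          + c * D.seminormP (D.discV vh - D.discV (D.piV v))
          + ε * ‖(v : L2 Ω) - vh‖)

/-- The approximation estimates for the seminorms, for the orders `j = 1` and `j = k`, and the
upper bounds for the stabilisation of interpolants, with constant `c`. -/
structure Approximation (c : ℝ) : Prop where
  approx1 : ∀ j, j = 1 ∨ j = k → ∀ (v : P.V) (hv : (v : L2 Ω) ∈ H Ω 2),
    (v : L2 Ω) ∈ H Ω (j + 1) →
      D.normL (D.incV v hv - D.discV (D.piV v))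
        + D.normPlus (D.incV v hv - D.discV (D.piV v))
        + D.seminormP (D.incV v hv - D.discV (D.piV v))
        ≤ c * meshSize T ^ j * hSeminorm Ω (j + 1) (v : L2 Ω)
  approx2 : ∀ j, j = 1 ∨ j = k → ∀ (w : P.W) (hw : (w : L2 Ω) ∈ H Ω 2),
    (w : L2 Ω) ∈ H Ω (j + 1) →
      D.normStar (D.incW w hw - D.discW (D.piW w))
        + D.seminormA (D.incW w hw - D.discW (D.piW w))
        ≤ c * meshSize T ^ j * hSeminorm Ω (j + 1) (w : L2 Ω)
  boundW : ∀ w : P.W, (w : L2 Ω) ∈ H Ω 2 →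
    D.seminormA (D.discW (D.piW w)) ≤ c * meshSize T * hSeminorm Ω 2 (w : L2 Ω)
  boundV : ∀ v : P.V, (v : L2 Ω) ∈ H Ω 2 →
    D.seminormP (D.discV (D.piV v)) ≤ c * meshSize T * hSeminorm Ω 2 (v : L2 Ω)

/-- `(u_h, z_h)` solves the stabilised primal-dual system with data `f` and exact solution `u`. -/
def IsFEMSol (f : L2 Ω) (u : P.V) (hu : (u : L2 Ω) ∈ H Ω 2) (p : D.Vh × D.Wh) : Prop :=
  (∀ wh : D.Wh, D.ah (D.discV p.1) (D.discW wh) + D.sa (D.discW p.2) (D.discW wh)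
    = inner ℝ f (wh : L2 Ω)) ∧
  (∀ vh : D.Vh, D.ah (D.discV vh) (D.discW p.2) - D.sp (D.discV p.1) (D.discV vh)
    = - D.sp (D.incV u hu) (D.discV vh))

/-- The error quantity `‖u - u_h‖ + h ‖∇(u - u_h)‖ + ‖z_h‖`. -/
def totalError (u : P.V) (p : D.Vh × D.Wh) : ℝ :=
  ‖(u : L2 Ω) - p.1‖ + meshSize T * hSeminorm Ω 1 ((u : L2 Ω) - p.1 : L2 Ω) + ‖(p.2 : L2 Ω)‖

end Discretisation

end

open scoped Pointwise

/-! ## Polynomial functions and the inverse inequality -/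

/-! The analysis rests on three identities for a discrete solution `(u_h, z_h)`. Testing with `z_h`
and `u_h - π_V u` cancels the indefinite parts of `a_h` and controls `x = |z_h|_{S_a}` and `y = |u_h
- π_V u|_{S_p}` by interpolation errors of `u`, up to a term with `ε ‖z_h‖` (`IsFEMSol.stability`).
A forward problem with data `z_h` and an adjoint problem with data `u - u_h` express `‖z_h‖²` and
`‖u - u_h‖²` through `a_h`. Subtracting the interpolant of the auxiliary solution, whose `H²`
seminorm is bounded by its data, gains a factor `t = c_γ c_Ω h` over the stabilisation seminorms
(`IsFEMSol.norm_dual_sq_le`, `IsFEMSol.norm_error_sq_le`).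

The three bounds are coupled through `ε`. Since `t ε ≤ 1/6`, the `ε` terms are absorbed, so `x + y`
is of the order of the interpolation error and both `L²` norms are smaller by a factor `t`
(`combine_stability_duality`).

The gradient error is split at `π_V u`; the discrete part is handled by the inverse inequality
`exists_inverse_inequality`. That one is proved by squeezing each simplex between two concentric
balls of comparable radii: equivalence of norms on polynomials on a fixed pair of balls, followed by
scaling, gives a constant depending only on `d`, `k`, `σ`, `τ`.

Unique solvability needs no inf-sup condition. The system is linear and square, and the error
estimate with zero data makes its kernel trivial (`systemMap_bijective`). -/

/-- The function on `E d` given by a polynomial. -/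
noncomputable def polyFun {d : ℕ} (p : MvPolynomial (Fin d) ℝ) (x : E d) : ℝ :=
  MvPolynomial.eval (fun i => x i) p

lemma polyFun_hasFDerivAt {d : ℕ} (p : MvPolynomial (Fin d) ℝ) (x : E d) :
    HasFDerivAt (polyFun p)
      (∑ i, polyFun (MvPolynomial.pderiv i p) x • (EuclideanSpace.proj i : E d →L[ℝ] ℝ)) x := by
  induction p using MvPolynomial.induction_on with
  | C a =>
    have h : (polyFun (MvPolynomial.C a) : E d → ℝ) = fun _ => a := by
      funext y; simp [polyFun]
    rw [h]
    simpa [polyFun] using hasFDerivAt_const a x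
  | add p q hp hq =>
    have h : (polyFun (p + q) : E d → ℝ) = fun y => polyFun p y + polyFun q y := by
      funext y; simp [polyFun]
    rw [h]
    refine (hp.add hq).congr_fderiv ?_
    rw [← Finset.sum_add_distrib]
    refine Finset.sum_congr rfl fun i _ => ?_
    simp [polyFun, add_smul]
  | mul_X p j hp =>
    have h : (polyFun (p * MvPolynomial.X j) : E d → ℝ) =
        fun y => polyFun p y * (EuclideanSpace.proj j : E d →L[ℝ] ℝ) y := by
      funext y; simp [polyFun]
    rw [h]
    refine (hp.mul (EuclideanSpace.proj j : E d →L[ℝ] ℝ).hasFDerivAt).congr_fderiv ?_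
    ext v
    simp only [polyFun, _root_.add_apply, _root_.smul_apply,
      _root_.sum_apply, Derivation.leibniz, MvPolynomial.pderiv_X, smul_eq_mul,
      map_add, map_mul, MvPolynomial.eval_X, add_mul, Finset.sum_add_distrib, Finset.mul_sum]
    congr 1
    · rw [Finset.sum_eq_single j]
      · simp
      · intro b _ hb
        simp [hb.symm]
      · simp
    · refine Finset.sum_congr rfl fun i _ => ?_
      simp [mul_assoc]

lemma fderiv_polyFun_single {d : ℕ} (p : MvPolynomial (Fin d) ℝ) (x : E d) (i : Fin d) :
    fderiv ℝ (polyFun p) x (EuclideanSpace.single i 1) = polyFun (MvPolynomial.pderiv i p) x := by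
  rw [(polyFun_hasFDerivAt p x).fderiv, _root_.sum_apply, Finset.sum_eq_single i]
  · simp
  · intro b _ hb
    simp [hb]
  · simp

lemma polyFun_differentiable {d : ℕ} (p : MvPolynomial (Fin d) ℝ) :
    Differentiable ℝ (polyFun p) := fun x => (polyFun_hasFDerivAt p x).differentiableAt

lemma polyFun_continuous {d : ℕ} (p : MvPolynomial (Fin d) ℝ) : Continuous (polyFun p) :=
  (polyFun_differentiable p).continuous

lemma polyFun_memLp_of_isBounded {d : ℕ} (p : MvPolynomial (Fin d) ℝ) {U : Set (E d)}
    (hU : Bornology.IsBounded U) : MemLp (polyFun p) 2 (volume.restrict U) := by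
  obtain ⟨R, hR⟩ := hU.subset_closedBall 0
  obtain ⟨M, hM⟩ := (isCompact_closedBall (0 : E d) R).exists_bound_of_continuousOn
    (polyFun_continuous p).continuousOn
  have : IsFiniteMeasure (volume.restrict (Metric.closedBall (0 : E d) R)) :=
    ⟨by simpa using measure_closedBall_lt_top⟩
  have h : MemLp (polyFun p) 2 (volume.restrict (Metric.closedBall (0 : E d) R)) :=
    MemLp.of_bound (polyFun_continuous p).aestronglyMeasurable M
      ((ae_restrict_iff' measurableSet_closedBall).2 (Filter.Eventually.of_forall hM))
  exact h.mono_measure (Measure.restrict_mono hR le_rfl)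

/-- A polynomial that vanishes almost everywhere on a ball vanishes. -/
lemma eq_zero_of_polyFun_ae_eq_zero {d : ℕ} {p : MvPolynomial (Fin d) ℝ} {x : E d} {r : ℝ}
    (hr : 0 < r) (h : polyFun p =ᵐ[volume.restrict (Metric.ball x r)] 0) : p = 0 := by
  have h0 : Set.EqOn (polyFun p) 0 (Metric.ball x r) :=
    Measure.eqOn_open_of_ae_eq h Metric.isOpen_ball (polyFun_continuous p).continuousOn
      continuousOn_const
  have hopen : IsOpen ((WithLp.toLp 2 : (Fin d → ℝ) → E d) ⁻¹' Metric.ball x r) :=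
    Metric.isOpen_ball.preimage (PiLp.continuous_toLp 2 _)
  have hx : WithLp.ofLp x ∈ (WithLp.toLp 2 : (Fin d → ℝ) → E d) ⁻¹' Metric.ball x r := by
    simpa using hr
  obtain ⟨δ, hδ, hsub⟩ := Metric.isOpen_iff.1 hopen _ hx
  -- In coordinates the ball contains a box, a product of infinite sets, and a polynomial vanishing
  -- on such a product is zero.
  refine MvPolynomial.funext_set (fun i => Metric.ball (x i) δ) (fun i => ?_) fun y hy => ?_
  · rw [Real.ball_eq_Ioo]
    exact Set.Ioo_infinite (by linarith)
  · have hy' : y ∈ Metric.ball (WithLp.ofLp x) δ := by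
      rw [← ball_pi _ hδ] at *
      exact hy
    simpa [polyFun] using h0 (hsub hy')

lemma totalDegree_aeval_le {d k : ℕ} (g : Fin d → MvPolynomial (Fin d) ℝ)
    (hg : ∀ i, (g i).totalDegree ≤ 1) (p : MvPolynomial (Fin d) ℝ) (hp : p.totalDegree ≤ k) :
    (MvPolynomial.aeval g p).totalDegree ≤ k := by
  rw [MvPolynomial.aeval_def, MvPolynomial.eval₂_eq]
  refine MvPolynomial.totalDegree_finsetSum_le fun s hs => ?_
  refine (MvPolynomial.totalDegree_mul _ _).trans ?_
  rw [MvPolynomial.algebraMap_eq, MvPolynomial.totalDegree_C, zero_add]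
  refine (MvPolynomial.totalDegree_finsetProd _ _).trans ?_
  refine le_trans ?_ ((MvPolynomial.le_totalDegree hs).trans hp)
  refine Finset.sum_le_sum fun i _ => ?_
  exact (MvPolynomial.totalDegree_pow _ _).trans (by nlinarith [hg i])

/-- Polynomials of degree at most `k` are stable under affine changes of variables. -/
lemma exists_polyFun_comp {d k : ℕ} (p : MvPolynomial (Fin d) ℝ) (hp : p.totalDegree ≤ k)
    (x : E d) (r : ℝ) :
    ∃ q : MvPolynomial (Fin d) ℝ, q.totalDegree ≤ k ∧ polyFun q = fun y => polyFun p (x + r • y) := by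
  refine ⟨MvPolynomial.aeval
    (fun i => MvPolynomial.C (x i) + MvPolynomial.C r * MvPolynomial.X i) p,
    totalDegree_aeval_le _ (fun i => ?_) p hp, ?_⟩
  · refine (MvPolynomial.totalDegree_add _ _).trans (max_le (by simp) ?_)
    refine (MvPolynomial.totalDegree_mul _ _).trans ?_
    simp
  · funext y
    simp only [polyFun]
    rw [← MvPolynomial.coe_aeval_eq_eval, ← MvPolynomial.coe_aeval_eq_eval]
    simp only [RingHom.coe_coe]
    rw [← AlgHom.comp_apply, MvPolynomial.comp_aeval]
    simp

/-- `T ∘ S⁻¹` is linear on the finite-dimensional range of `S`, hence bounded. With `S` and `T`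
mapping into `L²` spaces on different balls, this is the source of the inverse inequality. -/
lemma exists_norm_le_of_injective {F X Y : Type*} [AddCommGroup F] [Module ℝ F]
    [FiniteDimensional ℝ F] [NormedAddCommGroup X] [NormedSpace ℝ X] [NormedAddCommGroup Y]
    [NormedSpace ℝ Y] (S : F →ₗ[ℝ] X) (T : F →ₗ[ℝ] Y) (hS : Function.Injective S) :
    ∃ C : ℝ, 0 ≤ C ∧ ∀ p, ‖T p‖ ≤ C * ‖S p‖ := by
  let e := LinearEquiv.ofInjective S hS
  let R := LinearMap.toContinuousLinearMap (T ∘ₗ e.symm.toLinearMap)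
  refine ⟨‖R‖, norm_nonneg R, fun p => ?_⟩
  have h := R.le_opNorm (e p)
  simpa [R, e] using h

lemma norm_toLp_sq {d : ℕ} {U : Set (E d)} {f : E d → ℝ} (hf : MemLp f 2 (volume.restrict U)) :
    ‖hf.toLp f‖ ^ 2 = ∫ x in U, f x ^ 2 := by
  rw [← real_inner_self_eq_norm_sq, L2.inner_def]
  refine integral_congr_ae (hf.coeFn_toLp.mono fun x hx => ?_)
  simp only [hx, real_inner_self_eq_norm_sq, Real.norm_eq_abs, sq_abs]

/-- The linear map sending a polynomial function to its class in `L²` of a bounded set. -/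
noncomputable def polyToL2 {d : ℕ} {U : Set (E d)} (hU : Bornology.IsBounded U) :
    MvPolynomial (Fin d) ℝ →ₗ[ℝ] L2 U where
  toFun p := (polyFun_memLp_of_isBounded p hU).toLp (polyFun p)
  map_add' p q := by
    rw [← MemLp.toLp_add]
    exact MemLp.toLp_congr _ _ (Filter.Eventually.of_forall fun x => by simp [polyFun])
  map_smul' c p := by
    rw [RingHom.id_apply, ← MemLp.toLp_const_smul]
    exact MemLp.toLp_congr _ _ (Filter.Eventually.of_forall fun x => by simp [polyFun])

/-- The inverse inequality between concentric balls of radii `1` and `σ`. -/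
lemma exists_pderiv_le_unit_ball (d k : ℕ) (σ : ℝ) :
    ∃ C : ℝ, 0 ≤ C ∧ ∀ p : MvPolynomial (Fin d) ℝ, p.totalDegree ≤ k → ∀ i,
      ∫ x in Metric.closedBall (0 : E d) σ, polyFun (MvPolynomial.pderiv i p) x ^ 2 ≤
        C * ∫ x in Metric.ball (0 : E d) 1, polyFun p x ^ 2 := by
  let F := MvPolynomial.restrictTotalDegree (Fin d) ℝ k
  let S : F →ₗ[ℝ] L2 (Metric.ball (0 : E d) 1) := polyToL2 Metric.isBounded_ball ∘ₗ F.subtype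
  have hS : Function.Injective S := by
    rw [← LinearMap.ker_eq_bot, LinearMap.ker_eq_bot']
    intro p hp
    refine Subtype.ext (eq_zero_of_polyFun_ae_eq_zero (x := (0 : E d)) one_pos ?_)
    have h := (polyFun_memLp_of_isBounded (p : MvPolynomial (Fin d) ℝ)
      (Metric.isBounded_ball (x := (0 : E d)) (r := 1))).coeFn_toLp
    refine h.symm.trans ?_
    have h2 : (polyFun_memLp_of_isBounded (p : MvPolynomial (Fin d) ℝ)
      (Metric.isBounded_ball (x := (0 : E d)) (r := 1))).toLp _ = 0 := hp
    rw [h2]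
    exact Lp.coeFn_zero _ _ _
  -- The derivative is measured on the outer ball and the function on the inner one, so that the
  -- bound passes to every set in between.
  let T : Fin d → F →ₗ[ℝ] L2 (Metric.closedBall (0 : E d) σ) := fun i =>
    polyToL2 Metric.isBounded_closedBall ∘ₗ (MvPolynomial.pderiv i).toLinearMap ∘ₗ F.subtype
  choose C hC0 hC using fun i => exists_norm_le_of_injective S (T i) hS
  -- The sum makes the constant independent of the direction `i`.
  refine ⟨∑ i, C i ^ 2, by positivity, fun p hp i => ?_⟩
  have h := hC i ⟨p, (MvPolynomial.mem_restrictTotalDegree _ _ _).2 hp⟩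
  have h1 := norm_toLp_sq (polyFun_memLp_of_isBounded (MvPolynomial.pderiv i p)
    (Metric.isBounded_closedBall (x := (0 : E d)) (r := σ)))
  have h2 := norm_toLp_sq (polyFun_memLp_of_isBounded p
    (Metric.isBounded_ball (x := (0 : E d)) (r := 1)))
  rw [← h1, ← h2]
  calc _ ≤ (C i * _) ^ 2 := pow_le_pow_left₀ (norm_nonneg _) h 2
    _ = C i ^ 2 * _ := mul_pow _ _ _
    _ ≤ _ := mul_le_mul_of_nonneg_right
      (Finset.single_le_sum (f := fun i => C i ^ 2) (fun _ _ => sq_nonneg _) (Finset.mem_univ i))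
      (sq_nonneg _)

lemma setIntegral_comp_add_smul {d : ℕ} (f : E d → ℝ) {s t : Set (E d)} (x : E d) {r : ℝ}
    (hr : 0 < r) (hst : (fun y => x + y) ⁻¹' t = r • s) :
    ∫ y in s, f (x + r • y) = (r ^ d)⁻¹ * ∫ y in t, f y := by
  have h := Measure.setIntegral_comp_smul_of_pos volume (fun y => f (x + y)) s hr
  rw [h, ← hst, (measurePreserving_add_left volume x).setIntegral_preimage_emb
    (measurableEmbedding_addLeft x), finrank_euclideanSpace_fin, smul_eq_mul]

/-- The inverse inequality on a bounded set between two concentric balls. -/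
lemma exists_pderiv_le (d k : ℕ) (σ : ℝ) :
    ∃ C : ℝ, 0 ≤ C ∧ ∀ p : MvPolynomial (Fin d) ℝ, p.totalDegree ≤ k →
      ∀ (U : Set (E d)) (x : E d) (r : ℝ), 0 < r → Metric.ball x r ⊆ U →
        U ⊆ Metric.closedBall x (σ * r) → ∀ i,
      r ^ 2 * ∫ y in U, polyFun (MvPolynomial.pderiv i p) y ^ 2 ≤ C * ∫ y in U, polyFun p y ^ 2 := by
  obtain ⟨C, hC0, hC⟩ := exists_pderiv_le_unit_ball d k σ
  refine ⟨C, hC0, fun p hp U x r hr hrU hUr i => ?_⟩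
  obtain ⟨q, hq, hqp⟩ := exists_polyFun_comp p hp x r
  have hint : ∀ p' : MvPolynomial (Fin d) ℝ, ∀ V : Set (E d), Bornology.IsBounded V →
      IntegrableOn (fun y => polyFun p' y ^ 2) V := fun p' V hV =>
    (polyFun_memLp_of_isBounded p' hV).integrable_sq
  have hder : ∀ y, polyFun (MvPolynomial.pderiv i q) y =
      r * polyFun (MvPolynomial.pderiv i p) (x + r • y) := by
    intro y
    have h1 : HasFDerivAt (fun y : E d => x + r • y) (r • ContinuousLinearMap.id ℝ (E d)) y :=
      ((hasFDerivAt_id y).const_smul r).const_add x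
    have h2 := ((polyFun_differentiable p (x + r • y)).hasFDerivAt.comp y h1).fderiv
    rw [← fderiv_polyFun_single, ← fderiv_polyFun_single, hqp]
    change fderiv ℝ (polyFun p ∘ fun y => x + r • y) y _ = _
    rw [h2]
    simp
  have hb1 : (fun y => x + y) ⁻¹' Metric.closedBall x (σ * r) = r • Metric.closedBall (0 : E d) σ := by
    ext y
    rw [smul_closedBall' hr.ne']
    simp [abs_of_pos hr, mul_comm]
  have hb2 : (fun y => x + y) ⁻¹' Metric.ball x r = r • Metric.ball (0 : E d) 1 := by
    ext y
    rw [smul_ball hr.ne']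
    simp [abs_of_pos hr]
  have h := hC q hq i
  simp_rw [hder, hqp, mul_pow] at h
  rw [integral_const_mul,
    setIntegral_comp_add_smul (fun y => polyFun (MvPolynomial.pderiv i p) y ^ 2) x hr hb1,
    setIntegral_comp_add_smul (fun y => polyFun p y ^ 2) x hr hb2] at h
  -- Both sides carry the same Jacobian, which cancels; the factor `r ^ 2` from the chain rule
  -- remains.
  have hpos : (0 : ℝ) < (r ^ d)⁻¹ := by positivity
  have h' : r ^ 2 * ∫ y in Metric.closedBall x (σ * r), polyFun (MvPolynomial.pderiv i p) y ^ 2 ≤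
      C * ∫ y in Metric.ball x r, polyFun p y ^ 2 := by
    refine le_of_mul_le_mul_left ?_ hpos
    linarith
  refine le_trans (mul_le_mul_of_nonneg_left ?_ (sq_nonneg r)) (h'.trans
    (mul_le_mul_of_nonneg_left ?_ hC0))
  · exact setIntegral_mono_set (hint _ _ Metric.isBounded_closedBall)
      (Filter.Eventually.of_forall fun _ => sq_nonneg _) hUr.eventuallyLE
  · exact setIntegral_mono_set (hint _ _ (Metric.isBounded_closedBall.subset hUr))
      (Filter.Eventually.of_forall fun _ => sq_nonneg _) hrU.eventuallyLE

/-! ## Weak derivatives -/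

/-- This is the fundamental lemma of the calculus of variations applied to `g - k`. It lets the
chosen `weakDeriv` be replaced by any explicit weak derivative. -/
lemma HasWeakDeriv.ae_eq {d m : ℕ} {U : Set (E d)} (hU : IsOpen U) {i : Fin m → Fin d}
    {v g k : E d → ℝ} (hg : HasWeakDeriv U i v g) (hk : HasWeakDeriv U i v k) :
    g =ᵐ[volume.restrict U] k := by
  have hloc : LocallyIntegrableOn (g - k) U volume :=
    locallyIntegrableOn_of_locallyIntegrable_restrict
      ((hg.1.sub hk.1).locallyIntegrable one_le_two)
  have h := hU.ae_eq_zero_of_integral_contDiff_smul_eq_zero hloc fun φ h1 h2 h3 => ?_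
  · rw [Filter.EventuallyEq, ae_restrict_iff' hU.measurableSet]
    filter_upwards [h] with x hx hxU
    exact sub_eq_zero.1 (hx hxU)
  · have hφ : IsTest U φ := ⟨h1, h2, h3⟩
    have e : ∫ x in U, g x * φ x = ∫ x in U, k x * φ x := by
      have := (hg.2 φ hφ).symm.trans (hk.2 φ hφ)
      exact mul_left_cancel₀ (pow_ne_zero m (by norm_num)) this
    rw [← setIntegral_eq_integral_of_forall_compl_eq_zero (s := U)]
    · have a3 := hg.1.integrable_mul (test_memLp U hφ)
      have a4 := hk.1.integrable_mul (test_memLp U hφ)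
      calc ∫ x in U, φ x • (g - k) x = ∫ x in U, (g x * φ x - k x * φ x) := by
            simp only [Pi.sub_apply, smul_eq_mul, mul_sub, mul_comm]
        _ = _ := integral_sub a3 a4
        _ = 0 := sub_eq_zero.2 e
    · intro x hx
      rw [image_eq_zero_of_notMem_tsupport fun hx' => hx (h3 hx'), zero_smul]

lemma HasWeakDeriv.weakDeriv_ae_eq {d m : ℕ} {U : Set (E d)} (hU : IsOpen U) {i : Fin m → Fin d}
    {v g : E d → ℝ} (hg : HasWeakDeriv U i v g) : weakDeriv U i v =ᵐ[volume.restrict U] g := by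
  have h : ∃ g, HasWeakDeriv U i v g := ⟨g, hg⟩
  rw [weakDeriv, dif_pos h]
  exact h.choose_spec.ae_eq hU hg

/-- A test function on `U'` is one on `U`, and it vanishes with all derivatives outside `U'`. -/
lemma HasWeakDeriv.restrict {d m : ℕ} {U U' : Set (E d)} (hU : MeasurableSet U) (h : U' ⊆ U)
    {i : Fin m → Fin d} {v g : E d → ℝ} (hg : HasWeakDeriv U i v g) : HasWeakDeriv U' i v g := by
  refine ⟨hg.1.mono_measure (Measure.restrict_mono h le_rfl), fun φ hφ => ?_⟩
  have hsupp : ∀ x ∉ U', φ =ᶠ[nhds x] 0 := fun x hx =>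
    notMem_tsupport_iff_eventuallyEq.1 fun hx' => hx (hφ.support hx')
  have key := hg.2 φ ⟨hφ.smooth, hφ.compact, hφ.support.trans h⟩
  rw [setIntegral_eq_of_subset_of_forall_sdiff_eq_zero hU h fun x hx => ?_,
    setIntegral_eq_of_subset_of_forall_sdiff_eq_zero hU h fun x hx => ?_] at key
  · exact key
  · rw [(hsupp x hx.2).self_of_nhds, Pi.zero_apply, mul_zero]
  · rw [partialDeriv, ((hsupp x hx.2).iteratedFDeriv ℝ m).self_of_nhds]
    simp

lemma partialDeriv_one {d : ℕ} (i : Fin 1 → Fin d) (φ : E d → ℝ) (x : E d) :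
    partialDeriv i φ x = fderiv ℝ φ x (EuclideanSpace.single (i 0) 1) := by
  rw [partialDeriv, iteratedFDeriv_one_apply]

/-- The compact support of `φ` turns both integrals into integrals over the whole space, where
integration by parts has no boundary term, whatever the boundary of `U`. -/
lemma hasWeakDeriv_polyFun {d : ℕ} {U : Set (E d)}
    (hb : Bornology.IsBounded U) (i : Fin 1 → Fin d) (p : MvPolynomial (Fin d) ℝ) :
    HasWeakDeriv U i (polyFun p) (polyFun (MvPolynomial.pderiv (i 0) p)) := by
  refine ⟨polyFun_memLp_of_isBounded _ hb, fun φ hφ => ?_⟩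
  have hsupp : ∀ x ∉ U, φ =ᶠ[nhds x] 0 := fun x hx =>
    notMem_tsupport_iff_eventuallyEq.1 fun hx' => hx (hφ.support hx')
  rw [setIntegral_eq_integral_of_forall_compl_eq_zero, setIntegral_eq_integral_of_forall_compl_eq_zero]
  · simp_rw [partialDeriv_one]
    have hd : Continuous fun x => fderiv ℝ φ x (EuclideanSpace.single (i 0) 1) :=
      (hφ.smooth.continuous_fderiv (by simp)).clm_apply continuous_const
    have hds : HasCompactSupport fun x => fderiv ℝ φ x (EuclideanSpace.single (i 0) 1) :=
      hφ.compact.fderiv_apply ℝ _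
    rw [integral_mul_fderiv_eq_neg_fderiv_mul_of_integrable]
    · simp [fderiv_polyFun_single]
    · simp_rw [fderiv_polyFun_single]
      exact ((polyFun_continuous _).mul hφ.smooth.continuous).integrable_of_hasCompactSupport
        hφ.compact.mul_left
    · exact ((polyFun_continuous _).mul hd).integrable_of_hasCompactSupport hds.mul_left
    · exact ((polyFun_continuous _).mul hφ.smooth.continuous).integrable_of_hasCompactSupport
        hφ.compact.mul_left
    · exact fun x _ => polyFun_differentiable p x
    · exact fun x _ => hφ.smooth.differentiable (by simp) x
  · intro x hx
    rw [(hsupp x hx).self_of_nhds, Pi.zero_apply, mul_zero]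
  · intro x hx
    rw [partialDeriv, ((hsupp x hx).iteratedFDeriv ℝ 1).self_of_nhds]
    simp

lemma hSeminorm_nonneg {d : ℕ} (U : Set (E d)) (m : ℕ) (v : E d → ℝ) : 0 ≤ hSeminorm U m v :=
  Real.sqrt_nonneg _

lemma hSeminorm_sq {d : ℕ} (U : Set (E d)) (m : ℕ) (v : E d → ℝ) :
    hSeminorm U m v ^ 2 = ∑ i : Fin m → Fin d, ∫ x in U, weakDeriv U i v x ^ 2 :=
  Real.sq_sqrt (Finset.sum_nonneg fun _ _ => integral_nonneg fun _ => sq_nonneg _)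

/-- Integrating `(g + k)² ≤ 2 (g² + k²)` suffices; the factor 2 replaces Minkowski's inequality and
only enters the final constant. -/
lemma hSeminorm_add_le {d m : ℕ} {Ω : Set (E d)} (hΩ : IsOpen Ω) {v w : L2 Ω} (hv : v ∈ H Ω m)
    (hw : w ∈ H Ω m) :
    hSeminorm Ω m (v + w : L2 Ω) ≤ 2 * (hSeminorm Ω m v + hSeminorm Ω m w) := by
  have key : hSeminorm Ω m (v + w : L2 Ω) ^ 2 ≤
      2 * (hSeminorm Ω m v ^ 2 + hSeminorm Ω m w ^ 2) := by
    simp only [hSeminorm_sq]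
    rw [← Finset.sum_add_distrib, Finset.mul_sum]
    refine Finset.sum_le_sum fun i _ => ?_
    obtain ⟨g, hg⟩ := hv m le_rfl i
    obtain ⟨k, hk⟩ := hw m le_rfl i
    have hgk : HasWeakDeriv Ω i (v + w : L2 Ω) (g + k) :=
      (hg.add (Lp.memLp v) (Lp.memLp w) hk).congr (Lp.coeFn_add v w).symm
    have e1 : ∫ x in Ω, weakDeriv Ω i (v + w : L2 Ω) x ^ 2 = ∫ x in Ω, (g + k) x ^ 2 :=
      integral_congr_ae ((hgk.weakDeriv_ae_eq hΩ).mono fun x hx => by simp only [hx])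
    have e2 : ∫ x in Ω, weakDeriv Ω i v x ^ 2 = ∫ x in Ω, g x ^ 2 :=
      integral_congr_ae ((hg.weakDeriv_ae_eq hΩ).mono fun x hx => by simp only [hx])
    have e3 : ∫ x in Ω, weakDeriv Ω i w x ^ 2 = ∫ x in Ω, k x ^ 2 :=
      integral_congr_ae ((hk.weakDeriv_ae_eq hΩ).mono fun x hx => by simp only [hx])
    rw [e1, e2, e3, ← integral_add hg.1.integrable_sq hk.1.integrable_sq, ← integral_const_mul]
    refine integral_mono (hg.1.add hk.1).integrable_sq
      ((hg.1.integrable_sq.add hk.1.integrable_sq).const_mul 2) fun x => ?_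
    simp only [Pi.add_apply]
    nlinarith [sq_nonneg (g x - k x)]
  have h1 := hSeminorm_nonneg Ω m v
  have h2 := hSeminorm_nonneg Ω m w
  refine le_of_sq_le_sq (key.trans ?_) (by positivity)
  nlinarith [mul_nonneg h1 h2]

/-! ## Triangulations -/

/-- The open simplex with vertices `K`. -/
abbrev openElement {d : ℕ} (K : Finset (E d)) : Set (E d) :=
  interior (convexHull ℝ (K : Set (E d)))

lemma isBounded_openElement {d : ℕ} (K : Finset (E d)) : Bornology.IsBounded (openElement K) :=
  (isBounded_convexHull.2 K.finite_toSet.isBounded).subset interior_subset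

lemma isBounded_element {d : ℕ} (K : Finset (E d)) :
    Bornology.IsBounded (convexHull ℝ (K : Set (E d))) :=
  isBounded_convexHull.2 K.finite_toSet.isBounded

lemma elementDiam_nonneg {d : ℕ} (K : Finset (E d)) : 0 ≤ elementDiam K := Metric.diam_nonneg

lemma meshSize_nonneg {d : ℕ} (T : SimplicialComplex ℝ (E d)) : 0 ≤ meshSize T :=
  Real.sSup_nonneg (by rintro _ ⟨K, -, rfl⟩; exact elementDiam_nonneg K)

/-- Two elements meet inside the hull of their common vertices. If the interiors met, this open
intersection would make the common vertices span the whole space affinely, contradicting affine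
independence of `K` at a vertex outside `K'`. -/
lemma disjoint_openElement {d : ℕ} {T : SimplicialComplex ℝ (E d)} {K K' : Finset (E d)}
    (hK : K ∈ elements T) (hK' : K' ∈ elements T) (hne : K ≠ K') :
    Disjoint (openElement K) (openElement K') := by
  rw [Set.disjoint_iff_inter_eq_empty]
  by_contra hemp
  have hsub : openElement K ∩ openElement K' ⊆ affineSpan ℝ ((K : Set (E d)) ∩ K') :=
    (Set.inter_subset_inter interior_subset interior_subset).trans
      ((T.inter_subset_convexHull hK.1 hK'.1).trans (convexHull_subset_affineSpan _))
  have htop : affineSpan ℝ ((K : Set (E d)) ∩ K') = ⊤ := by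
    rw [eq_top_iff, ← (isOpen_interior.inter isOpen_interior).affineSpan_eq_top
      (Set.nonempty_iff_ne_empty.2 hemp)]
    exact affineSpan_le.2 hsub
  obtain ⟨p, hpK, hpK'⟩ : ∃ p ∈ K, p ∉ K' := by
    by_contra! h
    exact hne (Finset.eq_of_subset_of_card_le h (by rw [hK.2, hK'.2]))
  have hind := (T.indep hK.1).notMem_affineSpan_sdiff ⟨p, hpK⟩ Set.univ
  refine hind (affineSpan_mono ℝ ?_ (htop ▸ AffineSubspace.mem_top ℝ (E d) p))
  rintro x ⟨hxK, hxK'⟩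
  refine ⟨⟨x, hxK⟩, ⟨Set.mem_univ _, fun h => hpK' ?_⟩, rfl⟩
  have hx : x = p := congrArg Subtype.val h
  exact hx ▸ hxK'

namespace IsTriangulation

variable {d : ℕ} {Ω : Set (E d)} {T : SimplicialComplex ℝ (E d)} (hT : IsTriangulation Ω T)
include hT

lemma isOpen : IsOpen Ω := hT.covers ▸ isOpen_interior

lemma finite_elements : (elements T).Finite := hT.finite.subset fun _ h => h.1

lemma openElement_subset {K : Finset (E d)} (hK : K ∈ elements T) : openElement K ⊆ Ω := by
  rw [← hT.covers]
  exact interior_mono (Set.subset_biUnion_of_mem (u := fun K : Finset (E d) =>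
    convexHull ℝ (K : Set (E d))) hK)

/-- The part of `Ω` missed by the open simplices lies in the finitely many frontiers of convex sets,
which are null sets. -/
lemma biUnion_openElement_ae_eq :
    (⋃ K ∈ hT.finite_elements.toFinset, openElement K : Set (E d)) =ᵐ[volume] Ω := by
  have hsub : (⋃ K ∈ hT.finite_elements.toFinset, openElement K : Set (E d)) ⊆ Ω :=
    Set.iUnion₂_subset fun K hK =>
      hT.openElement_subset (hT.finite_elements.mem_toFinset.1 hK)
  refine hsub.eventuallyLE.antisymm ?_
  rw [ae_le_set]
  refine measure_mono_null (t := ⋃ K ∈ elements T, frontier (convexHull ℝ (K : Set (E d)))) ?_ ?_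
  · rintro x ⟨hx, hx'⟩
    rw [← hT.covers] at hx
    obtain ⟨K, hK, hxK⟩ := Set.mem_iUnion₂.1 (interior_subset hx)
    refine Set.mem_iUnion₂.2 ⟨K, hK, subset_closure hxK, fun h => hx' ?_⟩
    exact Set.mem_iUnion₂.2 ⟨K, hT.finite_elements.mem_toFinset.2 hK, h⟩
  · rw [measure_biUnion_null_iff hT.finite_elements.countable]
    exact fun K _ => (convex_convexHull ℝ _).addHaar_frontier volume

lemma setIntegral_eq_sum {f : E d → ℝ} (hf : IntegrableOn f Ω) :
    ∫ x in Ω, f x = ∑ K ∈ hT.finite_elements.toFinset, ∫ x in openElement K, f x := by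
  rw [← setIntegral_congr_set hT.biUnion_openElement_ae_eq]
  refine integral_biUnion_finset _ (fun _ _ => isOpen_interior.measurableSet) ?_ ?_
  · intro K hK K' hK' hne
    exact disjoint_openElement (hT.finite_elements.mem_toFinset.1 hK)
      (hT.finite_elements.mem_toFinset.1 hK') hne
  · exact fun K hK => hf.mono_set (hT.openElement_subset (hT.finite_elements.mem_toFinset.1 hK))

end IsTriangulation

/-! ## The inverse inequality for finite element functions -/

lemma sq_norm_L2 {d : ℕ} {U : Set (E d)} (v : L2 U) : ‖v‖ ^ 2 = ∫ x in U, v x ^ 2 := by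
  rw [← norm_toLp_sq (Lp.memLp v), Lp.toLp_coeFn]

/-- The inverse inequality on one element. -/
lemma exists_element_inverse_inequality (d k : ℕ) (σ : ℝ) :
    ∃ C : ℝ, 0 ≤ C ∧ ∀ (Ω : Set (E d)) (K : Finset (E d)) (x : E d) (r : ℝ),
      IsOpen Ω → openElement K ⊆ Ω → 0 < r →
      Metric.closedBall x r ⊆ convexHull ℝ (K : Set (E d)) → elementDiam K ≤ σ * r →
      ∀ v : L2 Ω, v ∈ H Ω 1 → IsPolyOn k K v → ∀ i : Fin 1 → Fin d,
        r ^ 2 * ∫ y in openElement K, weakDeriv Ω i v y ^ 2 ≤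
          C * ∫ y in openElement K, v y ^ 2 := by
  obtain ⟨C, hC0, hC⟩ := exists_pderiv_le d k σ
  refine ⟨C, hC0, fun Ω K x r hΩ hKΩ hr hball hdiam v hv hpoly i => ?_⟩
  obtain ⟨p, hp, hvp⟩ := hpoly
  have hvp' : v =ᵐ[volume.restrict (openElement K)] polyFun p := hvp
  obtain ⟨g, hg⟩ := hv 1 le_rfl i
  have h1 : weakDeriv Ω i v =ᵐ[volume.restrict (openElement K)] g :=
    ae_mono (Measure.restrict_mono hKΩ le_rfl) (hg.weakDeriv_ae_eq hΩ)
  -- On `K` the global weak derivative must agree with the classical derivative of the local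
  -- polynomial, by uniqueness.
  have h2 : g =ᵐ[volume.restrict (openElement K)] polyFun (MvPolynomial.pderiv (i 0) p) :=
    (hg.restrict hΩ.measurableSet hKΩ).ae_eq isOpen_interior
      ((hasWeakDeriv_polyFun (isBounded_openElement K) i p).congr hvp'.symm)
  have e1 : ∫ y in openElement K, weakDeriv Ω i v y ^ 2 =
      ∫ y in openElement K, polyFun (MvPolynomial.pderiv (i 0) p) y ^ 2 :=
    integral_congr_ae ((h1.trans h2).mono fun y hy => by simp only [hy])
  have e2 : ∫ y in openElement K, v y ^ 2 = ∫ y in openElement K, polyFun p y ^ 2 :=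
    integral_congr_ae (hvp'.mono fun y hy => by simp only [hy])
  rw [e1, e2]
  -- The element lies in the ball of radius `σ * r` about `x`, since `x` belongs to it and its
  -- diameter is at most `σ * r`.
  refine hC p hp _ x r hr
    (interior_maximal (Metric.ball_subset_closedBall.trans hball) Metric.isOpen_ball) ?_ (i 0)
  intro y hy
  exact (Metric.dist_le_diam_of_mem (isBounded_element K) (interior_subset hy)
    (hball (Metric.mem_closedBall_self hr.le))).trans hdiam

/-- The inverse inequality `h ‖∇ v‖ ≤ C ‖v‖` for finite element functions. -/
lemma exists_inverse_inequality (d k : ℕ) (σ τ : ℝ) (hτ : 0 < τ) (hσ : 0 < σ) :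
    ∃ C : ℝ, 0 ≤ C ∧ ∀ (Ω : Set (E d)) (T : SimplicialComplex ℝ (E d)),
      IsTriangulation Ω T → ShapeRegular T σ → QuasiUniform T τ →
      ∀ v : L2 Ω, IsFEFunction T k v → meshSize T * hSeminorm Ω 1 v ≤ C * ‖v‖ := by
  obtain ⟨C, hC0, hC⟩ := exists_element_inverse_inequality d k σ
  let M : ℝ := (Finset.univ : Finset (Fin 1 → Fin d)).card * ((τ * σ) ^ 2 * C)
  have hM : 0 ≤ M := by positivity
  refine ⟨Real.sqrt M, Real.sqrt_nonneg _, fun Ω T hT hs hq v hv => ?_⟩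
  have hh := meshSize_nonneg T
  refine le_of_sq_le_sq ?_ (by positivity)
  rw [mul_pow, mul_pow, Real.sq_sqrt hM, hSeminorm_sq, sq_norm_L2, Finset.mul_sum, mul_assoc,
    ← nsmul_eq_mul]
  refine Finset.sum_le_card_nsmul _ _ _ fun i _ => ?_
  have hsq : IntegrableOn (fun x => weakDeriv Ω i v x ^ 2) Ω := by
    obtain ⟨g, hg⟩ := hv.1 1 le_rfl i
    exact hg.1.integrable_sq.congr
      ((hg.weakDeriv_ae_eq hT.isOpen).mono fun x hx => by simp only [hx])
  rw [hT.setIntegral_eq_sum hsq, hT.setIntegral_eq_sum (Lp.memLp v).integrable_sq,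
    Finset.mul_sum, Finset.mul_sum]
  refine Finset.sum_le_sum fun K hK => ?_
  have hK := hT.finite_elements.mem_toFinset.1 hK
  obtain ⟨x, r, hball, hdiam⟩ := hs K hK
  have hmesh : meshSize T ≤ τ * σ * r := by
    rw [mul_assoc]
    exact (hq K hK).trans (mul_le_mul_of_nonneg_left hdiam hτ.le)
  have hI : 0 ≤ ∫ y in openElement K, weakDeriv Ω i v y ^ 2 := integral_nonneg fun _ => sq_nonneg _
  have hI' : 0 ≤ ∫ y in openElement K, v y ^ 2 := integral_nonneg fun _ => sq_nonneg _
  -- Shape regularity as stated admits `r ≤ 0`; then the mesh size vanishes and so does the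
  -- left-hand side.
  rcases le_or_gt r 0 with hr | hr
  · have h0 : meshSize T = 0 :=
      le_antisymm (hmesh.trans (mul_nonpos_of_nonneg_of_nonpos (by positivity) hr)) hh
    rw [h0, zero_pow two_ne_zero, zero_mul]
    positivity
  · have h1 := hC Ω K x r hT.isOpen (hT.openElement_subset hK) hr hball hdiam v hv.1 (hv.2 K hK) i
    calc _ ≤ (τ * σ * r) ^ 2 * ∫ y in openElement K, weakDeriv Ω i v y ^ 2 := by gcongr
      _ = (τ * σ) ^ 2 * (r ^ 2 * ∫ y in openElement K, weakDeriv Ω i v y ^ 2) := by ring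
      _ ≤ (τ * σ) ^ 2 * (C * ∫ y in openElement K, v y ^ 2) := by gcongr
      _ = _ := by ring

/-! ## Finite dimension of finite element spaces -/

/-- Restriction of square integrable functions to a subset. -/
noncomputable def restrictL2 {d : ℕ} {U U' : Set (E d)} (h : U' ⊆ U) : L2 U →ₗ[ℝ] L2 U' where
  toFun v := ((Lp.memLp v).mono_measure (Measure.restrict_mono h le_rfl)).toLp v
  map_add' v w := by
    rw [← MemLp.toLp_add]
    exact MemLp.toLp_congr _ _ (ae_mono (Measure.restrict_mono h le_rfl) (Lp.coeFn_add v w))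
  map_smul' c v := by
    rw [RingHom.id_apply, ← MemLp.toLp_const_smul]
    exact MemLp.toLp_congr _ _ (ae_mono (Measure.restrict_mono h le_rfl) (Lp.coeFn_smul c v))

/-- Restriction to all open elements embeds `S` into a finite product of spaces of polynomials of
degree at most `k`; injectivity holds because the elements fill `Ω` up to a null set. -/
lemma finiteDimensional_of_isFEFunction {d k : ℕ} {Ω : Set (E d)} {T : SimplicialComplex ℝ (E d)}
    (hT : IsTriangulation Ω T) (S : Submodule ℝ (L2 Ω)) (hS : ∀ v ∈ S, IsFEFunction T k v) :
    FiniteDimensional ℝ S := by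
  have : Finite (elements T) := hT.finite_elements
  let Q : elements T → Submodule ℝ (MvPolynomial (Fin d) ℝ) :=
    fun _ => MvPolynomial.restrictTotalDegree (Fin d) ℝ k
  let R : ∀ K : elements T, Submodule ℝ (L2 (openElement (K : Finset (E d)))) :=
    fun K => (Q K).map (polyToL2 (isBounded_openElement _))
  have hmem : ∀ (K : elements T) (v : S),
      (restrictL2 (hT.openElement_subset K.2) ∘ₗ S.subtype) v ∈ R K := by
    rintro K ⟨v, hv⟩
    obtain ⟨p, hp, hvp⟩ := (hS v hv).2 K K.2
    refine ⟨p, (MvPolynomial.mem_restrictTotalDegree _ _ _).2 hp, ?_⟩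
    exact MemLp.toLp_congr (polyFun_memLp_of_isBounded p (isBounded_openElement _))
      ((Lp.memLp v).mono_measure (Measure.restrict_mono (hT.openElement_subset K.2) le_rfl))
      (Filter.EventuallyEq.symm hvp)
  let f : S →ₗ[ℝ] (∀ K, R K) := LinearMap.pi fun K =>
    (restrictL2 (hT.openElement_subset K.2) ∘ₗ S.subtype).codRestrict (R K) (hmem K)
  refine FiniteDimensional.of_injective f ?_
  rw [← LinearMap.ker_eq_bot, LinearMap.ker_eq_bot']
  rintro ⟨v, hv⟩ hfv
  refine Subtype.ext ?_
  change v = 0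
  rw [← norm_eq_zero, ← sq_eq_zero_iff, sq_norm_L2,
    hT.setIntegral_eq_sum (Lp.memLp v).integrable_sq]
  refine Finset.sum_eq_zero fun K hK => ?_
  have hK := hT.finite_elements.mem_toFinset.1 hK
  have h0 : restrictL2 (hT.openElement_subset hK) v = 0 :=
    congrArg Subtype.val (congrFun hfv ⟨K, hK⟩)
  have h1 := norm_toLp_sq ((Lp.memLp v).mono_measure
    (Measure.restrict_mono (hT.openElement_subset hK) le_rfl))
  rw [← h1]
  change ‖restrictL2 (hT.openElement_subset hK) v‖ ^ 2 = 0
  rw [h0, norm_zero, sq, mul_zero]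

/-! ## Error estimates -/

lemma le_of_sq_le_mul_self {a b : ℝ} (hb : 0 ≤ b) (h : a ^ 2 ≤ a * b) : a ≤ b := by
  rcases le_or_gt a 0 with ha | ha
  · exact ha.trans hb
  · exact le_of_mul_le_mul_left (by rwa [← sq]) ha

/-- The algebra that combines the stability estimate and the two duality estimates. -/
lemma combine_stability_duality {ca ε t η A L S x y Z e : ℝ} (hca : 0 < ca) (hε : 0 ≤ ε)
    (ht : 0 ≤ t) (htε : t * ε ≤ 1 / 6) (hA : 0 ≤ A) (hL : 0 ≤ L) (hS : 0 ≤ S) (hx : 0 ≤ x)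
    (hy : 0 ≤ y) (hZ : 0 ≤ Z) (he : 0 ≤ e) (hη : L + A + S ≤ η)
    (h1 : x ^ 2 + y ^ 2 ≤ A * (ca * x + ε * Z) + S * y)
    (h2 : Z ^ 2 ≤ Z * (t * (ca * x + ε * Z + y + S)))
    (h3 : e ^ 2 ≤ e * (t * (ca * L + ca * y + ε * e + x))) :
    Z ≤ 2 * (ca + 1) * (4 * (ca + 1) + 1) * (t * η) ∧
      e ≤ 2 * (ca + 1) * (4 * (ca + 1) + 1) * (t * η) := by
  have hη0 : 0 ≤ η := by linarith
  have h2' : Z ≤ t * (ca * x + ε * Z + y + S) := le_of_sq_le_mul_self (by positivity) h2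
  have h3' : e ≤ t * (ca * L + ca * y + ε * e + x) := le_of_sq_le_mul_self (by positivity) h3
  -- Multiplying the bound for `Z` by `ε` and using `t * ε ≤ 1 / 6` leaves `5/6` of `ε * Z` on the
  -- left.
  have hεZ : ε * Z ≤ 1 / 5 * (ca * x + y + S) := by
    have a : ε * Z ≤ ε * (t * (ca * x + ε * Z + y + S)) := mul_le_mul_of_nonneg_left h2' hε
    have b : (t * ε) * (ca * x + ε * Z + y + S) ≤ 1 / 6 * (ca * x + ε * Z + y + S) :=
      mul_le_mul_of_nonneg_right htε (by positivity)
    linarith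
  -- Otherwise, with `s = x + y`, the bound `b3` on `x² + y²` would be at most `(3/10 + 1/80) s²`,
  -- whereas `x² + y² ≥ s²/2`.
  have hs : x + y ≤ 4 * (ca + 1) * η := by
    by_contra! hlt
    have hAη : A ≤ η := by linarith
    have hSη : S ≤ η := by linarith
    have b1 : A * (ca * x + ε * Z) ≤ η * (ca * x + 1 / 5 * (ca * x + y + η)) :=
      mul_le_mul hAη (by linarith) (by positivity) hη0
    have b2 : S * y ≤ η * y := mul_le_mul_of_nonneg_right hSη hy
    have b3 : x ^ 2 + y ^ 2 ≤ η * (6 / 5 * ((ca + 1) * (x + y)) + η / 5) := by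
      nlinarith [mul_nonneg hη0 hx, mul_nonneg hη0 (mul_nonneg hca.le hy)]
    have hpos : 0 ≤ 4 * (ca + 1) * η := by positivity
    have hs0 : 0 < x + y := hpos.trans_lt hlt
    have b4 : (4 * (ca + 1) * η) * (x + y) ≤ (x + y) * (x + y) :=
      mul_le_mul_of_nonneg_right hlt.le hs0.le
    have b5 : 4 * η ≤ x + y := by nlinarith [mul_nonneg hca.le hη0]
    have b6 : (4 * η) * (4 * η) ≤ (x + y) * (x + y) := mul_self_le_mul_self (by positivity) b5
    nlinarith [sq_nonneg (x - y), mul_pos hs0 hs0]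
  -- Absorbing `ε * q` costs a factor `6/5`, rounded up to 2.
  have key : ∀ q B : ℝ, 0 ≤ q → q ≤ t * (B + ε * q) →
      B ≤ (ca + 1) * (4 * (ca + 1) + 1) * η →
      q ≤ 2 * (ca + 1) * (4 * (ca + 1) + 1) * (t * η) := by
    intro q B hq h hB
    have a : (t * ε) * q ≤ 1 / 6 * q := mul_le_mul_of_nonneg_right htε hq
    have b : t * B ≤ t * ((ca + 1) * (4 * (ca + 1) + 1) * η) := mul_le_mul_of_nonneg_left hB ht
    nlinarith
  have hcs : (ca + 1) * (x + y) ≤ (ca + 1) * (4 * (ca + 1) * η) :=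
    mul_le_mul_of_nonneg_left hs (by positivity)
  constructor
  · refine key Z (ca * x + y + S) hZ (by linarith) ?_
    nlinarith [mul_nonneg hca.le hy, mul_nonneg hca.le hη0]
  · refine key e (ca * L + ca * y + x) he (by linarith) ?_
    nlinarith [mul_nonneg hca.le hx, mul_nonneg hca.le hη0,
      mul_le_mul_of_nonneg_left (show L ≤ η by linarith) hca.le]

namespace Discretisation

variable {d k : ℕ} {Ω : Set (E d)} {P : Problem Ω} {T : SimplicialComplex ℝ (E d)}
  (D : Discretisation P T k)

lemma seminormP_nonneg (v : D.SV) : 0 ≤ D.seminormP v := Real.sqrt_nonneg _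

lemma seminormA_nonneg (w : D.SW) : 0 ≤ D.seminormA w := Real.sqrt_nonneg _

lemma seminormP_sq (v : D.SV) : D.seminormP v ^ 2 = D.sp v v := Real.sq_sqrt (D.sp_nonneg v)

lemma seminormA_sq (w : D.SW) : D.seminormA w ^ 2 = D.sa w w := Real.sq_sqrt (D.sa_nonneg w)

lemma abs_sp_le (v w : D.SV) : |D.sp v w| ≤ D.seminormP v * D.seminormP w := by
  rw [seminormP, seminormP, ← Real.sqrt_mul (D.sp_nonneg v)]
  exact Real.abs_le_sqrt (LinearMap.BilinForm.apply_sq_le_of_symm D.sp D.sp_nonneg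
    ⟨fun v w => D.sp_symm v w⟩ v w)

lemma abs_sa_le (v w : D.SW) : |D.sa v w| ≤ D.seminormA v * D.seminormA w := by
  rw [seminormA, seminormA, ← Real.sqrt_mul (D.sa_nonneg v)]
  exact Real.abs_le_sqrt (LinearMap.BilinForm.apply_sq_le_of_symm D.sa D.sa_nonneg
    ⟨fun v w => D.sa_symm v w⟩ v w)

lemma discV_sub (v w : D.Vh) : D.discV (v - w) = D.discV v - D.discV w := rfl

variable {D} {ca ci cΩ cγ ε : ℝ}

/-- Stability of the method in the stabilisation seminorms. -/
lemma IsFEMSol.stability (hcons : D.Consistent) (hcont : D.Continuity ca ε) {f : L2 Ω} {u : P.V}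
    {hu : (u : L2 Ω) ∈ H Ω 2} (hfu : P.IsForwardSol f u) {p : D.Vh × D.Wh}
    (hp : D.IsFEMSol f u hu p) :
    D.seminormA (D.discW p.2) ^ 2 + D.seminormP (D.discV p.1 - D.discV (D.piV u)) ^ 2 ≤
      D.normPlus (D.incV u hu - D.discV (D.piV u))
          * (ca * D.seminormA (D.discW p.2) + ε * ‖(p.2 : L2 Ω)‖)
        + D.seminormP (D.incV u hu - D.discV (D.piV u))
          * D.seminormP (D.discV p.1 - D.discV (D.piV u)) := by
  -- The tests `z_h` and `u_h - π_V u`, together with consistency, give `s_a(z_h, z_h) + s_p(u_h -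
  -- π_V u, u_h - π_V u) = a_h(u - π_V u, z_h) + s_p(u - π_V u, u_h - π_V u)`.
  have e1 := hp.1 p.2
  have e2 := hp.2 (p.1 - D.piV u)
  have e3 : D.ah (D.incV u hu) (D.discW p.2) = inner ℝ f (p.2 : L2 Ω) :=
    hcons.forward f u hu hfu (D.discW p.2)
  have h1 := hcont.cont1 u hu p.2
  have h2 := (abs_le.1 (D.abs_sp_le (D.incV u hu - D.discV (D.piV u))
    (D.discV p.1 - D.discV (D.piV u)))).2
  rw [seminormA_sq, seminormP_sq]
  refine le_trans (le_of_eq ?_) (add_le_add h1 h2)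
  simp only [discV_sub, map_sub, LinearMap.sub_apply] at *
  linarith

/-- Bound for the dual variable by a duality argument. -/
lemma IsFEMSol.norm_dual_sq_le (hwp : P.WellPosed) (hsm : P.Smoothing cΩ) (hcγ : 0 < cγ)
    (hcons : D.Consistent) (hca : 0 < ca) (hε : 0 ≤ ε) (hcont : D.Continuity ca ε)
    (happ : D.Approximation cγ) {f : L2 Ω} {u : P.V}
    {hu : (u : L2 Ω) ∈ H Ω 2} {p : D.Vh × D.Wh} (hp : D.IsFEMSol f u hu p) :
    ‖(p.2 : L2 Ω)‖ ^ 2 ≤ ‖(p.2 : L2 Ω)‖ * (cγ * cΩ * meshSize T *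
      (ca * D.seminormA (D.discW p.2) + ε * ‖(p.2 : L2 Ω)‖
        + D.seminormP (D.discV p.1 - D.discV (D.piV u))
        + D.seminormP (D.incV u hu - D.discV (D.piV u)))) := by
  -- The auxiliary forward problem has data `z_h`, so consistency tested with `z_h` yields `‖z_h‖²`.
  obtain ⟨φ, hφ, -⟩ := hwp.forward p.2
  obtain ⟨hφ2, hφs⟩ := hsm.forward _ φ hφ
  have hh := meshSize_nonneg T
  have e1 : D.ah (D.incV φ hφ2) (D.discW p.2) = inner ℝ (p.2 : L2 Ω) (p.2 : L2 Ω) :=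
    hcons.forward _ φ hφ2 hφ (D.discW p.2)
  rw [real_inner_self_eq_norm_sq] at e1
  -- The second equation turns `a_h(π_V φ, z_h)` into `s_p(u_h - u, π_V φ)`, and the seminorm of
  -- `π_V φ` is itself of order `h`.
  have e2 := hp.2 (D.piV φ)
  have h1 := hcont.cont1 φ hφ2 p.2
  have h2 := (abs_le.1 (D.abs_sp_le (D.discV p.1 - D.discV (D.piV u)) (D.discV (D.piV φ)))).2
  have h3 := (abs_le.1 (D.abs_sp_le (D.incV u hu - D.discV (D.piV u)) (D.discV (D.piV φ)))).1
  have a1 := happ.approx1 1 (Or.inl rfl) φ hφ2 hφ2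
  have a2 := happ.boundV φ hφ2
  have hN := apply_nonneg D.normL (D.incV φ hφ2 - D.discV (D.piV φ))
  have hP := D.seminormP_nonneg (D.incV φ hφ2 - D.discV (D.piV φ))
  rw [pow_one] at a1
  have a3 : cγ * meshSize T * hSeminorm Ω (1 + 1) (φ : L2 Ω) ≤
      cγ * meshSize T * (cΩ * ‖(p.2 : L2 Ω)‖) := mul_le_mul_of_nonneg_left hφs (by positivity)
  have hx := D.seminormA_nonneg (D.discW p.2)
  have hy := D.seminormP_nonneg (D.discV p.1 - D.discV (D.piV u))
  have hS := D.seminormP_nonneg (D.incV u hu - D.discV (D.piV u))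
  have b1 : D.normPlus (D.incV φ hφ2 - D.discV (D.piV φ)) ≤
      cγ * cΩ * meshSize T * ‖(p.2 : L2 Ω)‖ := by linarith
  have b2 : D.seminormP (D.discV (D.piV φ)) ≤ cγ * cΩ * meshSize T * ‖(p.2 : L2 Ω)‖ := by
    linarith
  have c1 := mul_le_mul_of_nonneg_right b1
    (show 0 ≤ ca * D.seminormA (D.discW p.2) + ε * ‖(p.2 : L2 Ω)‖ by positivity)
  have c2 := mul_le_mul_of_nonneg_left b2 hy
  have c3 := mul_le_mul_of_nonneg_left b2 hS
  have key : ‖(p.2 : L2 Ω)‖ ^ 2 =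
      D.ah (D.incV φ hφ2 - D.discV (D.piV φ)) (D.discW p.2)
        + D.sp (D.discV p.1 - D.discV (D.piV u)) (D.discV (D.piV φ))
        - D.sp (D.incV u hu - D.discV (D.piV u)) (D.discV (D.piV φ)) := by
    simp only [map_sub, LinearMap.sub_apply]
    linarith
  linarith

/-- Bound for the error by a duality argument. -/
lemma IsFEMSol.norm_error_sq_le (hwp : P.WellPosed) (hsm : P.Smoothing cΩ) (hcγ : 0 < cγ)
    (hcons : D.Consistent) (hca : 0 < ca) (hε : 0 ≤ ε) (hcont : D.Continuity ca ε)
    (happ : D.Approximation cγ) {f : L2 Ω} {u : P.V}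
    {hu : (u : L2 Ω) ∈ H Ω 2} (hfu : P.IsForwardSol f u) {p : D.Vh × D.Wh}
    (hp : D.IsFEMSol f u hu p) :
    ‖(u : L2 Ω) - p.1‖ ^ 2 ≤ ‖(u : L2 Ω) - p.1‖ * (cγ * cΩ * meshSize T *
      (ca * D.normL (D.incV u hu - D.discV (D.piV u))
        + ca * D.seminormP (D.discV p.1 - D.discV (D.piV u))
        + ε * ‖(u : L2 Ω) - p.1‖ + D.seminormA (D.discW p.2))) := by
  -- The Aubin–Nitsche argument: Galerkin orthogonality holds only up to the stabilisation term
  -- `s_a(z_h, π_W ψ)`, which is kept.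
  obtain ⟨ψ, hψ, -⟩ := hwp.adjoint ((u : L2 Ω) - p.1)
  obtain ⟨hψ2, hψs⟩ := hsm.adjoint _ ψ hψ
  have hh := meshSize_nonneg T
  have e1 : D.ah (D.incV u hu - D.discV p.1) (D.incW ψ hψ2) =
      inner ℝ ((u : L2 Ω) - p.1) ((u : L2 Ω) - p.1) :=
    hcons.adjoint _ ψ hψ2 hψ (D.incV u hu - D.discV p.1)
  rw [real_inner_self_eq_norm_sq] at e1
  have e2 := hp.1 (D.piW ψ)
  have e3 : D.ah (D.incV u hu) (D.discW (D.piW ψ)) = inner ℝ f (D.piW ψ : L2 Ω) :=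
    hcons.forward f u hu hfu (D.discW (D.piW ψ))
  have h1 := hcont.cont2 u hu ψ hψ2 p.1
  have h2 := (abs_le.1 (D.abs_sa_le (D.discW p.2) (D.discW (D.piW ψ)))).2
  have a1 := happ.approx2 1 (Or.inl rfl) ψ hψ2 hψ2
  have a2 := happ.boundW ψ hψ2
  have hA := D.seminormA_nonneg (D.incW ψ hψ2 - D.discW (D.piW ψ))
  rw [pow_one] at a1
  have a3 : cγ * meshSize T * hSeminorm Ω (1 + 1) (ψ : L2 Ω) ≤
      cγ * meshSize T * (cΩ * ‖(u : L2 Ω) - p.1‖) :=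
    mul_le_mul_of_nonneg_left hψs (by positivity)
  have hx := D.seminormA_nonneg (D.discW p.2)
  have hy := D.seminormP_nonneg (D.discV p.1 - D.discV (D.piV u))
  have hL := apply_nonneg D.normL (D.incV u hu - D.discV (D.piV u))
  have b1 : D.normStar (D.incW ψ hψ2 - D.discW (D.piW ψ)) ≤
      cγ * cΩ * meshSize T * ‖(u : L2 Ω) - p.1‖ := by linarith
  have b2 : D.seminormA (D.discW (D.piW ψ)) ≤ cγ * cΩ * meshSize T * ‖(u : L2 Ω) - p.1‖ := by
    linarith
  have c1 := mul_le_mul_of_nonneg_right b1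
    (show 0 ≤ ca * D.normL (D.incV u hu - D.discV (D.piV u))
        + ca * D.seminormP (D.discV p.1 - D.discV (D.piV u))
        + ε * ‖(u : L2 Ω) - p.1‖ by positivity)
  have c2 := mul_le_mul_of_nonneg_left b2 hx
  have key : ‖(u : L2 Ω) - p.1‖ ^ 2 =
      D.ah (D.incV u hu - D.discV p.1) (D.incW ψ hψ2 - D.discW (D.piW ψ))
        + D.sa (D.discW p.2) (D.discW (D.piW ψ)) := by
    simp only [map_sub, LinearMap.sub_apply] at e1 ⊢
    linarith
  linarith

/-- The error estimate of order `j + 1` for `j = 1` and `j = k`. -/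
lemma IsFEMSol.totalError_le (hcγ : 0 < cγ) (hca : 0 < ca) {c : ℝ} (hc : 0 ≤ c)
    (hT : IsTriangulation Ω T)
    (hinv : ∀ v : L2 Ω, IsFEFunction T k v → meshSize T * hSeminorm Ω 1 v ≤ c * ‖v‖)
    (hcΩ : 0 < cΩ) (hwp : P.WellPosed) (hsm : P.Smoothing cΩ) (hcons : D.Consistent)
    (hint : D.Interpolation ci) (hε : 0 ≤ ε) (hcont : D.Continuity ca ε)
    (happ : D.Approximation cγ) (hsmall : cγ * cΩ * meshSize T * ε ≤ 1 / 6)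
    {f : L2 Ω} {u : P.V} {hu : (u : L2 Ω) ∈ H Ω 2} (hfu : P.IsForwardSol f u)
    {p : D.Vh × D.Wh} (hp : D.IsFEMSol f u hu p) {j : ℕ} (hj : j = 1 ∨ j = k)
    (huj : (u : L2 Ω) ∈ H Ω (j + 1)) :
    D.totalError u p ≤
      2 * (1 + c) * (2 * (ca + 1) * (4 * (ca + 1) + 1) * (cγ * cΩ * cγ) + ci)
        * meshSize T ^ (j + 1) * hSeminorm Ω (j + 1) (u : L2 Ω) := by
  have hh := meshSize_nonneg T
  obtain ⟨hZ, he⟩ := combine_stability_duality hca hε (t := cγ * cΩ * meshSize T)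
    (by positivity) hsmall (apply_nonneg D.normPlus _) (apply_nonneg D.normL _)
    (D.seminormP_nonneg _) (D.seminormA_nonneg _) (D.seminormP_nonneg _) (norm_nonneg _)
    (norm_nonneg _) (happ.approx1 j hj u hu huj)
    (hp.stability hcons hcont hfu) (hp.norm_dual_sq_le hwp hsm hcγ hcons hca hε hcont happ)
    (hp.norm_error_sq_le hwp hsm hcγ hcons hca hε hcont happ hfu)
  have hI := hint.piV j hj u huj
  set Q : ℝ := meshSize T ^ (j + 1) * hSeminorm Ω (j + 1) (u : L2 Ω) with hQ
  set N : ℝ := 2 * (ca + 1) * (4 * (ca + 1) + 1) with hN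
  have eQ : cγ * cΩ * meshSize T * (cγ * meshSize T ^ j * hSeminorm Ω (j + 1) (u : L2 Ω)) =
      cγ * cΩ * cγ * Q := by rw [hQ]; ring
  rw [eQ, ← mul_assoc] at hZ he
  have hb : 0 ≤ meshSize T ^ 2 * brokenSeminorm T 2 ((u : L2 Ω) - D.piV u : L2 Ω) :=
    mul_nonneg (by positivity) (Real.sqrt_nonneg _)
  have hg : 0 ≤ meshSize T * hSeminorm Ω 1 ((u : L2 Ω) - D.piV u : L2 Ω) :=
    mul_nonneg hh (hSeminorm_nonneg _ _ _)
  have hn : 0 ≤ ‖(u : L2 Ω) - D.piV u‖ := norm_nonneg _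
  rw [mul_assoc ci, ← hQ] at hI
  have hfe : ((D.piV u - p.1 : D.Vh) : L2 Ω) ∈ D.Vh := (D.piV u - p.1).2
  have hi := hinv _ (D.Vh_fe _ hfe)
  have htri : ‖((D.piV u - p.1 : D.Vh) : L2 Ω)‖ ≤
      ‖(u : L2 Ω) - p.1‖ + ‖(u : L2 Ω) - D.piV u‖ := by
    rw [show ((D.piV u - p.1 : D.Vh) : L2 Ω) =
      ((u : L2 Ω) - p.1) - ((u : L2 Ω) - D.piV u) by
        rw [sub_sub_sub_cancel_left]; rfl]
    exact norm_sub_le _ _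
  -- Only `π_V u - u_h` is discrete, so the inverse inequality is applied to it; `u - π_V u` is
  -- covered by the interpolation estimate.
  have hgrad : hSeminorm Ω 1 ((u : L2 Ω) - p.1 : L2 Ω) ≤
      2 * (hSeminorm Ω 1 ((u : L2 Ω) - D.piV u : L2 Ω)
        + hSeminorm Ω 1 ((D.piV u - p.1 : D.Vh) : L2 Ω)) := by
    have h := hSeminorm_add_le (v := (u : L2 Ω) - D.piV u)
      (w := ((D.piV u - p.1 : D.Vh) : L2 Ω)) (m := 1) hT.isOpen
      ((H Ω 1).sub_mem (P.V_le u.2) (D.Vh_fe _ (D.piV u).2).1) (D.Vh_fe _ hfe).1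
    rwa [show (u : L2 Ω) - D.piV u + ((D.piV u - p.1 : D.Vh) : L2 Ω) = (u : L2 Ω) - p.1 from
      sub_add_sub_cancel _ _ _] at h
  have hgrad' := mul_le_mul_of_nonneg_left hgrad hh
  have hi' := hi.trans (mul_le_mul_of_nonneg_left
    (htri.trans (add_le_add he (show _ ≤ ci * Q by linarith))) hc)
  rw [totalError, mul_assoc _ (meshSize T ^ (j + 1)), ← hQ]
  linarith

/-! ### Unique solvability of the discrete system -/

variable (D)

/-- Inclusion of `V_h` as a linear map. -/
noncomputable def discVₗ : D.Vh →ₗ[ℝ] D.SV := Submodule.inclusion le_sup_right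

/-- Inclusion of `W_h` as a linear map. -/
noncomputable def discWₗ : D.Wh →ₗ[ℝ] D.SW := Submodule.inclusion le_sup_right

/-- The linear operator of the discrete primal-dual system. -/
noncomputable def systemMap :
    (D.Vh × D.Wh) →ₗ[ℝ] Module.Dual ℝ D.Wh × Module.Dual ℝ D.Vh :=
  LinearMap.prod
    (D.ah.compl₁₂ D.discVₗ D.discWₗ ∘ₗ LinearMap.fst ℝ D.Vh D.Wh
      + D.sa.compl₁₂ D.discWₗ D.discWₗ ∘ₗ LinearMap.snd ℝ D.Vh D.Wh)
    ((D.ah.compl₁₂ D.discVₗ D.discWₗ).flip ∘ₗ LinearMap.snd ℝ D.Vh D.Wh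
      - D.sp.compl₁₂ D.discVₗ D.discVₗ ∘ₗ LinearMap.fst ℝ D.Vh D.Wh)

lemma isFEMSol_iff (f : L2 Ω) (u : P.V) (hu : (u : L2 Ω) ∈ H Ω 2) (p : D.Vh × D.Wh) :
    D.IsFEMSol f u hu p ↔ D.systemMap p =
      ((innerₗ (L2 Ω) f) ∘ₗ D.Wh.subtype, -(D.sp (D.incV u hu) ∘ₗ D.discVₗ)) := by
  rw [Prod.ext_iff, LinearMap.ext_iff, LinearMap.ext_iff]
  rfl

/-- An element of the kernel solves the system with `f = 0` and `u = 0`, where the error is the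
solution itself. Injectivity gives surjectivity because the duals of `W_h` and `V_h` have the same
total dimension as `V_h × W_h`. -/
lemma systemMap_bijective (hT : IsTriangulation Ω T)
    (h : ∀ p, D.IsFEMSol 0 0 (H Ω 2).zero_mem p → D.totalError 0 p ≤ 0) :
    Function.Bijective D.systemMap := by
  have := finiteDimensional_of_isFEFunction hT D.Vh D.Vh_fe
  have := finiteDimensional_of_isFEFunction hT D.Wh D.Wh_fe
  have hinj : Function.Injective D.systemMap := by
    rw [← LinearMap.ker_eq_bot, LinearMap.ker_eq_bot']
    intro p hp
    have hsol : D.IsFEMSol 0 0 (H Ω 2).zero_mem p := by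
      rw [isFEMSol_iff, hp, Prod.ext_iff]
      have h0 : D.incV 0 (H Ω 2).zero_mem = 0 := rfl
      constructor
      · ext w; simp
      · ext v; simp [h0]
    have h1 := h p hsol
    have h2 : 0 ≤ meshSize T * hSeminorm Ω 1 (((0 : P.V) : L2 Ω) - p.1 : L2 Ω) :=
      mul_nonneg (meshSize_nonneg T) (hSeminorm_nonneg _ _ _)
    have h3 := norm_nonneg (((0 : P.V) : L2 Ω) - p.1)
    have h4 := norm_nonneg (p.2 : L2 Ω)
    rw [totalError] at h1
    have h5 : ‖((0 : P.V) : L2 Ω) - p.1‖ = 0 := by linarith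
    have h6 : ‖(p.2 : L2 Ω)‖ = 0 := by linarith
    rw [Submodule.coe_zero, zero_sub, norm_neg, norm_eq_zero] at h5
    rw [norm_eq_zero] at h6
    exact Prod.ext (Subtype.ext h5) (Subtype.ext h6)
  refine ⟨hinj, (LinearMap.injective_iff_surjective_of_finrank_eq_finrank ?_).1 hinj⟩
  rw [Module.finrank_prod, Module.finrank_prod, Subspace.dual_finrank_eq,
    Subspace.dual_finrank_eq, add_comm]

end Discretisation

/-! ### Choice of constants and conclusion -/

theorem mainTheorem1 (d k : ℕ) (hd : d = 2 ∨ d = 3) (hk : 1 ≤ k)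
    (cΩ cγ : ℝ) (hcΩ : 0 < cΩ) (hcγ : 0 < cγ) :
    ∃ c₀ : ℝ, 0 < c₀ ∧
      ∀ ca ci σ τ : ℝ, 0 < ca → 0 < ci → 0 < σ → 0 < τ →
        ∃ C : ℝ, 0 < C ∧
          ∀ (Ω : Set (E d)) (P : Problem Ω) (T : SimplicialComplex ℝ (E d))
            (D : Discretisation P T k) (ε : ℝ),
            IsTriangulation Ω T → ShapeRegular T σ → QuasiUniform T τ →
            P.WellPosed → P.Smoothing cΩ →
            D.Consistent → D.Interpolation ci → 0 ≤ ε → D.Continuity ca ε →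
            D.Approximation cγ →
            c₀ * meshSize T * ε ≤ 1 / 6 →
            ∀ (f : L2 Ω) (u : P.V) (hu : (u : L2 Ω) ∈ H Ω 2), P.IsForwardSol f u →
              ∃ p : D.Vh × D.Wh,
                D.IsFEMSol f u hu p ∧ (∀ q : D.Vh × D.Wh, D.IsFEMSol f u hu q → q = p) ∧
                ((u : L2 Ω) ∈ H Ω (k + 1) →
                  D.totalError u p
                    ≤ C * meshSize T ^ (k + 1) * hSeminorm Ω (k + 1) (u : L2 Ω)) ∧
                D.totalError u p ≤ C * meshSize T ^ 2 * ‖f‖ := by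

  -- With this choice the smallness condition is exactly `t * ε ≤ 1 / 6` for the duality factor `t`.
  refine ⟨cγ * cΩ, by positivity, fun ca ci σ τ hca hci hσ hτ => ?_⟩
  obtain ⟨c, hc, hinv⟩ := exists_inverse_inequality d k σ τ hτ hσ
  let C₁ : ℝ := 2 * (1 + c) * (2 * (ca + 1) * (4 * (ca + 1) + 1) * (cγ * cΩ * cγ) + ci)
  have hC₁ : 0 < C₁ := by positivity
  -- The factor `1 + cΩ` dominates both 1, for the bound by the seminorm of `u`, and `cΩ`, for the
  -- bound by `‖f‖`.
  refine ⟨C₁ * (1 + cΩ), by positivity, ?_⟩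
  intro Ω P T D ε hT hsr hqu hwp hsm hcons hint hε hcont happ hsmall f u hu hfu
  have hh := meshSize_nonneg T
  have est : ∀ (f : L2 Ω) (u : P.V) (hu : (u : L2 Ω) ∈ H Ω 2), P.IsForwardSol f u →
      ∀ p, D.IsFEMSol f u hu p → ∀ j, j = 1 ∨ j = k → (u : L2 Ω) ∈ H Ω (j + 1) →
        D.totalError u p ≤ C₁ * meshSize T ^ (j + 1) * hSeminorm Ω (j + 1) (u : L2 Ω) :=
    fun f u hu hfu p hp j hj huj =>
      hp.totalError_le hcγ hca hc hT (hinv Ω T hT hsr hqu) hcΩ hwp hsm hcons hint hε hcont happ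
        hsmall hfu hj huj
  have est₂ : ∀ (f : L2 Ω) (u : P.V) (hu : (u : L2 Ω) ∈ H Ω 2), P.IsForwardSol f u →
      ∀ p, D.IsFEMSol f u hu p →
        D.totalError u p ≤ C₁ * (1 + cΩ) * meshSize T ^ 2 * ‖f‖ := by
    intro f u hu hfu p hp
    have h1 := est f u hu hfu p hp 1 (Or.inl rfl) hu
    have h2 := (hsm.forward f u hfu).2
    calc D.totalError u p ≤ C₁ * meshSize T ^ 2 * hSeminorm Ω 2 (u : L2 Ω) := h1
      _ ≤ C₁ * meshSize T ^ 2 * (cΩ * ‖f‖) := by gcongr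
      _ = C₁ * meshSize T ^ 2 * ‖f‖ * cΩ := by ring
      _ ≤ C₁ * meshSize T ^ 2 * ‖f‖ * (1 + cΩ) := by gcongr; linarith
      _ = _ := by ring
  have hzero : P.IsForwardSol 0 0 := fun w => by simp
  obtain ⟨hinj, hsurj⟩ := D.systemMap_bijective hT fun p hp =>
    (est₂ 0 0 (H Ω 2).zero_mem hzero p hp).trans (by simp)
  obtain ⟨p, hp⟩ := hsurj
    ((innerₗ (L2 Ω) f) ∘ₗ D.Wh.subtype, -(D.sp (D.incV u hu) ∘ₗ D.discVₗ))
  have hsol : D.IsFEMSol f u hu p := (D.isFEMSol_iff f u hu p).2 hp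
  refine ⟨p, hsol, fun q hq => hinj (((D.isFEMSol_iff f u hu q).1 hq).trans hp.symm),
    fun huk => ?_, est₂ f u hu hfu p hsol⟩
  refine (est f u hu hfu p hsol k (Or.inr rfl) huk).trans ?_
  have := hSeminorm_nonneg Ω (k + 1) (u : L2 Ω)
  gcongr
  nlinarith
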